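/- Let $n,k$ be integers with $1\le k\le n/2$ and let $\alpha\in\mathbb R$ with $\alpha+2k>0$. Write $B_r=\{x\in\mathbb R^n:|x|<r\}$. For a positive $C^2$ function $u$ on an open set of $\mathbb R^n$ put $A_{ij}(u)=u\,u_{ij}-\tfrac12|\nabla u|^2\delta_{ij}$, let $\lambda(A(u))$ be the eigenvalues of the symmetric matrix $A(u)$, and for $j\ge 0$ let $S_j(u)=\sigma_j(\lambda(A(u)))$, where $\sigma_j$ is the $j$-th elementary symmetric polynomial (so $S_0=1$). Let $\Gamma_k=\{\lambda\in\mathbb R^n:\sigma_i(\lambda)\ge 0\text{ for }1\le i\le k\}$. For an open set $\Omega\subset\mathbb R^n$ let $\tilde\Phi^k(\Omega)$ be the set of positive $u\in C^2(\Omega)$ with $\lambda(A(u))\in\Gamma_k$ at every point of $\Omega$, and let $\Phi^k(\Omega)$ be the set of positive $u\in L^1_{\mathrm{loc}}(\Omega)$ that are limits in $L^1_{\mathrm{loc}}(\Omega)$ of sequences in $\tilde\Phi^k(\Omega)$. Then there is a constant $C>0$ depending only on $n,k,\alpha$ such that every $u\in\Phi^k(B_3)\cap C^2(B_3)$ satisfies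 $$\int_{B_1}\sum_{l=0}^{k}u^{\alpha}|\nabla u|^{2l}S_{k-l}(u)\,dx\le C\,\|u\|_{L^1(B_2)}^{2k+\alpha},$$ where the integrals are finite. -/

import Mathlib

open MeasureTheory Filter Topology

noncomputable section

namespace SigmaKYamabe

/-- Hessian matrix `u_{ij} = ∂_i ∂_j u` of a function on `ℝⁿ`. -/
def hessian {n : ℕ} (u : EuclideanSpace ℝ (Fin n) → ℝ) (x : EuclideanSpace ℝ (Fin n)) :
    Matrix (Fin n) (Fin n) ℝ :=
  Matrix.of fun i j =>
    fderiv ℝ (fderiv ℝ u) x (EuclideanSpace.single i 1) (EuclideanSpace.single j 1)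

/-- The matrix `A_{ij}(u) = u u_{ij} - (1/2) |∇u|² δ_{ij}`. -/
def schouten {n : ℕ} (u : EuclideanSpace ℝ (Fin n) → ℝ) (x : EuclideanSpace ℝ (Fin n)) :
    Matrix (Fin n) (Fin n) ℝ :=
  u x • hessian u x - ((1 / 2 : ℝ) * ‖gradient u x‖ ^ 2) • (1 : Matrix (Fin n) (Fin n) ℝ)

/-- The eigenvalues of a matrix, counted with multiplicity. For a symmetric real matrix (the only
case that occurs for `A(u)` with `u` of class `C²`) this multiset has exactly `n` elements. -/
def eigenvalues {n : ℕ} (A : Matrix (Fin n) (Fin n) ℝ) : Multiset ℝ :=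
  A.charpoly.roots

/-- Gårding's (closed) cone: `σ_i(lam) ≥ 0` for `1 ≤ i ≤ k`, where `σ_i` is the elementary symmetric
polynomial. The conditions are symmetric, so it is a set of unordered tuples. -/
def gardingCone (k : ℕ) : Set (Multiset ℝ) :=
  {lam | ∀ i : ℕ, 1 ≤ i → i ≤ k → 0 ≤ lam.esymm i}

/-- The `σ_k`-Yamabe operator `S_k(u) = σ_k(λ(A(u)))`; in particular `S_0(u) = 1`. -/
def S {n : ℕ} (k : ℕ) (u : EuclideanSpace ℝ (Fin n) → ℝ) (x : EuclideanSpace ℝ (Fin n)) : ℝ :=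
  (eigenvalues (schouten u x)).esymm k

/-- The class of positive `u ∈ C²(Ω)` with `λ(A(u)) ∈ Γ_k` at every point of the open set `Ω`. -/
def PhiTilde {n : ℕ} (k : ℕ) (Ω : Set (EuclideanSpace ℝ (Fin n))) :
    Set (EuclideanSpace ℝ (Fin n) → ℝ) :=
  {u | ContDiffOn ℝ 2 u Ω ∧ (∀ x ∈ Ω, 0 < u x) ∧
    ∀ x ∈ Ω, eigenvalues (schouten u x) ∈ gardingCone k}

/-- Positive functions in `L¹_loc(Ω)` that are limits in `L¹_loc(Ω)` of sequences in
`PhiTilde k Ω`. -/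
def Phi {n : ℕ} (k : ℕ) (Ω : Set (EuclideanSpace ℝ (Fin n))) :
    Set (EuclideanSpace ℝ (Fin n) → ℝ) :=
  {u | LocallyIntegrableOn u Ω volume ∧ (∀ x ∈ Ω, 0 < u x) ∧
    ∃ v : ℕ → EuclideanSpace ℝ (Fin n) → ℝ, (∀ m, v m ∈ PhiTilde k Ω) ∧
      ∀ K : Set (EuclideanSpace ℝ (Fin n)), IsCompact K → K ⊆ Ω →
        Tendsto (fun m => eLpNorm (v m - u) 1 (volume.restrict K)) atTop (𝓝 0)}

end SigmaKYamabe

end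

/-!
The proof has three ingredients.

*Admissibility of the limit.* A function `u ∈ Φ^k(B_3)` of class `C²` belongs to `Φ̃^k(B_3)`
(`mem_phiTilde`). Functions in `Φ̃^k` are subharmonic, so the mean value inequality with a radial
weight (`mean_value_weight`) upgrades `L¹_loc` convergence `v_m → u` to a locally uniform bound
`v_m ≤ u + o(1)`. If `A(u)` left the cone at `x₀`, then `u + ε |x - x₀|² + c` would touch some `v_m`
from above near `x₀` at a point where its own 2-jet is not admissible; this contradicts the
monotonicity of Gårding's cone under adding positive semidefinite matrices.

*A divergence formula.* With the Newton transformations `T_i = T_i(A(u))` one has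
`u ∂_a T_i^{ab} = n T_i^{ab} u_a - (n - i) σ_i u_b` (`div_newton_of_codazzi`), so that the divergence
of `ζ u^{α+1} |∇u|^{2l} T_i ∇u` contains no third derivatives of `u` (`flux_eq`) and integrates to
zero, first for smooth and then by mollification for `C²` functions (`integral_flux_eq_zero`).
For `l = k - 1 - i` and `0 ≤ i < k` these are `k` linear relations between
`X_m = ∫ ζ u^α |∇u|^{2(k-m)} σ_m`, `Y_i = ∫ ζ u^α |∇u|^{2(k-1-i)} T_i(∇u, ∇u)` and terms with
`∇ζ`. All `X_m` and `Y_i` are nonnegative on Gårding's cone (`newton_posSemidef`, a consequence of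
Newton's inequalities), and a suitable positive combination of the relations has only positive
coefficients (`exists_weights`); this is exactly where `α + 2k > 0` and `2k ≤ n` enter.

*Induction.* For `ζ = η²`, Young's inequality for the form `T_i` absorbs the terms with `∇ζ` into
the `Y_i`, at the cost of the same energy for `(k - 1, α + 2)` on a larger ball
(`exists_pointwise_bound`). As `α + 2k` is unchanged, induction on `k` leads to `∫ u^{α+2k}`
(`integral_energy_le`), and this is bounded through `sup u ≤ C ‖u‖_{L¹}`, which is again the mean
value inequality.
-/

/-! ### Elementary symmetric functions and Gårding's cone -/

namespace SigmaKYamabe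

section

open Polynomial

theorem esymm_cons_succ (a : ℝ) (s : Multiset ℝ) (m : ℕ) :
    (a ::ₘ s).esymm (m + 1) = s.esymm (m + 1) + a * s.esymm m := by
  simp [Multiset.esymm, Multiset.powersetCard_cons, Multiset.map_map,
    Multiset.sum_map_mul_left]

theorem esymm_zero' (s : Multiset ℝ) : s.esymm 0 = 1 := by
  simp [Multiset.esymm]

/-- `∏ (1 + a X)` is the generating polynomial of the elementary symmetric functions. -/
theorem coeff_prod_one_add (s : Multiset ℝ) (m : ℕ) :
    ((s.map (fun a => (1 : ℝ[X]) + X * C a)).prod).coeff m = s.esymm m := by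
  induction s using Multiset.induction generalizing m with
  | empty =>
    cases m with
    | zero => simp [esymm_zero']
    | succ m => simp [Multiset.esymm, coeff_one, Multiset.powersetCard_zero_right]
  | cons a s ih =>
    rw [Multiset.map_cons, Multiset.prod_cons, add_mul, one_mul, mul_assoc, coeff_add]
    cases m with
    | zero => rw [ih]; simp [esymm_zero']
    | succ m => rw [coeff_X_mul, coeff_C_mul, ih, ih, esymm_cons_succ]

/-- By Rolle's theorem the derivative of a real-rooted polynomial is real-rooted. -/
theorem splits_derivative_real {p : ℝ[X]} (hp : p.Splits) : (derivative p).Splits := by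
  rw [splits_iff_card_roots] at hp ⊢
  have h1 := card_roots_le_derivative p
  have h2 := natDegree_derivative_le p
  have h3 := card_roots' (derivative p)
  rcases Nat.eq_zero_or_pos p.natDegree with h | h
  · have : derivative p = 0 := by
      rw [eq_C_of_natDegree_eq_zero h]; simp
    simp [this]
  · omega

/-- Laguerre's inequality `p p'' ≤ (p')²` for real-rooted polynomials. -/
theorem laguerre {p : ℝ[X]} (hp : p.Splits) (x : ℝ) :
    p.eval x * (derivative (derivative p)).eval x ≤ (derivative p).eval x ^ 2 := by
  have key : ∀ s : Multiset ℝ,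
      ((s.map (fun a => X - C a)).prod).eval x *
        (derivative (derivative (s.map (fun a => X - C a)).prod)).eval x
        ≤ (derivative ((s.map (fun a => X - C a)).prod)).eval x ^ 2 := by
    intro s
    induction s using Multiset.induction with
    | empty => simp
    | cons a s ih =>
      rw [Multiset.map_cons, Multiset.prod_cons]
      set g := (s.map (fun a => X - C a)).prod
      simp only [derivative_mul, derivative_add, derivative_sub, derivative_X, derivative_C,
        eval_add, eval_mul, eval_sub, eval_X, eval_C, sub_zero, one_mul]
      nlinarith [mul_nonneg (sq_nonneg (x - a)) (sub_nonneg.2 ih), sq_nonneg (g.eval x)]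
  have h := key p.roots
  have e : p = C p.leadingCoeff * (p.roots.map (fun a => X - C a)).prod := hp.eq_prod_roots
  rw [e]
  set g := (p.roots.map (fun a => X - C a)).prod
  simp only [derivative_C_mul, eval_mul, eval_C]
  nlinarith [mul_nonneg (sq_nonneg p.leadingCoeff) (sub_nonneg.2 h)]

/-- Newton's inequality between consecutive elementary symmetric functions of real numbers. -/
theorem esymm_newton (s : Multiset ℝ) (m : ℕ) :
    ((m : ℝ) + 2) * (s.esymm m * s.esymm (m + 2)) ≤ ((m : ℝ) + 1) * s.esymm (m + 1) ^ 2 := by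
  set p : ℝ[X] := (s.map (fun a => (1 : ℝ[X]) + X * C a)).prod with hp
  have hs : p.Splits := by
    refine Splits.multisetProd ?_
    intro q hq
    obtain ⟨a, -, rfl⟩ := Multiset.mem_map.1 hq
    apply Splits.of_natDegree_le_one
    compute_degree
  -- Laguerre's inequality for the `m`-th derivative at `0` involves three consecutive coefficients
  have hd : ∀ j, (derivative^[j] p).Splits := by
    intro j
    induction j with
    | zero => exact hs
    | succ j ih => rw [Function.iterate_succ_apply']; exact splits_derivative_real ih
  have h := laguerre (hd m) 0
  rw [← Function.iterate_succ_apply' derivative, ← Function.iterate_succ_apply' derivative] at h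
  simp only [← coeff_zero_eq_eval_zero, coeff_iterate_derivative, zero_add, Nat.descFactorial_self,
    hp, coeff_prod_one_add, nsmul_eq_mul] at h
  have f1 : ((m + 1).factorial : ℝ) = (m + 1) * m.factorial := by
    rw [Nat.factorial_succ]; push_cast; ring
  have f2 : ((m + 1 + 1).factorial : ℝ) = (m + 2) * ((m + 1) * m.factorial) := by
    rw [Nat.factorial_succ, Nat.cast_mul, f1]; push_cast; ring
  simp only [Nat.succ_eq_add_one] at h
  rw [f1, f2] at h
  have hf : (0 : ℝ) < m.factorial := by exact_mod_cast m.factorial_pos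
  have hm : (0 : ℝ) < m + 1 := by positivity
  have h' : ((m.factorial : ℝ) ^ 2 * (m + 1)) * (((m : ℝ) + 2) * (s.esymm m * s.esymm (m + 2))) ≤
      ((m.factorial : ℝ) ^ 2 * (m + 1)) * (((m : ℝ) + 1) * s.esymm (m + 1) ^ 2) := by
    linarith
  exact le_of_mul_le_mul_left h' (by positivity)

/-- Deleting an entry of a tuple in `Γ_{k+1}` gives a tuple in `Γ_k`. -/
theorem esymm_nonneg_of_cons (a : ℝ) (s : Multiset ℝ) (k : ℕ)
    (h : (a ::ₘ s) ∈ gardingCone (k + 1)) : ∀ j ≤ k, 0 ≤ s.esymm j := by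
  intro j
  induction j with
  | zero => intro _; simp [esymm_zero']
  | succ j ih =>
    intro hj
    by_contra hneg
    push Not at hneg
    have h1 := h (j + 1) (by omega) (by omega)
    have h2 := h (j + 2) (by omega) (by omega)
    rw [esymm_cons_succ] at h1 h2
    have h0 := ih (by omega)
    have hN := esymm_newton s j
    have hj0 : (0 : ℝ) ≤ j := Nat.cast_nonneg j
    set x := s.esymm j
    set y := s.esymm (j + 1)
    set z := s.esymm (j + 2)
    -- `x z ≥ -a x y ≥ y²`, against the strict form of Newton's inequality
    have hxz : y ^ 2 ≤ x * z := by nlinarith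
    nlinarith [sq_pos_of_neg hneg]

end

/-! ### Newton transformations of symmetric matrices -/

section

open Polynomial Matrix

variable {n : ℕ}

/-- The matrix pencil `1 + X A` over `ℝ[X]`; its determinant is the generating polynomial of the
elementary symmetric functions of the eigenvalues of `A`. -/
noncomputable def pencil (A : Matrix (Fin n) (Fin n) ℝ) : Matrix (Fin n) (Fin n) ℝ[X] :=
  1 + (X : ℝ[X]) • A.map C

/-- The `m`-th elementary symmetric function of the eigenvalues of `A`, as a polynomial in the
entries of `A`. -/
noncomputable def sig (m : ℕ) (A : Matrix (Fin n) (Fin n) ℝ) : ℝ := (pencil A).det.coeff m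

/-- The `m`-th Newton transformation `T_m(A) = σ_m(A) - σ_{m-1}(A) A + ⋯ + (-1)^m A^m`. -/
noncomputable def newton : ℕ → Matrix (Fin n) (Fin n) ℝ → Matrix (Fin n) (Fin n) ℝ
  | 0, _ => 1
  | m + 1, A => sig (m + 1) A • (1 : Matrix (Fin n) (Fin n) ℝ) - A * newton m A

theorem newton_zero (A : Matrix (Fin n) (Fin n) ℝ) : newton 0 A = 1 := rfl

theorem newton_succ (m : ℕ) (A : Matrix (Fin n) (Fin n) ℝ) :
    newton (m + 1) A = sig (m + 1) A • (1 : Matrix (Fin n) (Fin n) ℝ) - A * newton m A := rfl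

theorem pencil_map_eval (A : Matrix (Fin n) (Fin n) ℝ) (t : ℝ) :
    (pencil A).map (eval t) = 1 + t • A := by
  ext i j
  by_cases h : i = j
  · subst h; simp [pencil, mul_comm t]
  · simp [pencil, h, Matrix.one_apply_ne, mul_comm t]

theorem eval_det_pencil (A : Matrix (Fin n) (Fin n) ℝ) (t : ℝ) :
    (pencil A).det.eval t = (1 + t • A).det := by
  rw [← pencil_map_eval, ← coe_evalRingHom, RingHom.map_det]; rfl

theorem eval_adjugate_pencil (A : Matrix (Fin n) (Fin n) ℝ) (t : ℝ) (i j : Fin n) :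
    ((pencil A).adjugate i j).eval t = (1 + t • A).adjugate i j := by
  rw [← pencil_map_eval, ← coe_evalRingHom]
  have := RingHom.map_adjugate (evalRingHom t) (pencil A)
  exact congrFun (congrFun this i) j

theorem sig_zero (A : Matrix (Fin n) (Fin n) ℝ) : sig 0 A = 1 := by
  rw [sig, coeff_zero_eq_eval_zero, eval_det_pencil]; simp

theorem det_pencil_ne_zero (A : Matrix (Fin n) (Fin n) ℝ) : (pencil A).det ≠ 0 := by
  intro h
  have := sig_zero A
  rw [sig, h] at this
  simp at this

theorem natDegree_det_pencil_le (A : Matrix (Fin n) (Fin n) ℝ) : (pencil A).det.natDegree ≤ n := by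
  have := natDegree_det_X_add_C_le A 1
  rw [Matrix.map_one _ C.map_zero C.map_one, add_comm] at this
  simpa [pencil] using this

/-- The Newton transformations are the coefficients of the adjugate of `1 + X A`. -/
theorem coeff_adjugate_pencil (A : Matrix (Fin n) (Fin n) ℝ) (m : ℕ) (i j : Fin n) :
    ((pencil A).adjugate i j).coeff m = newton m A i j := by
  have h : ∀ i j, (pencil A).adjugate i j + X * ∑ k, C (A i k) * (pencil A).adjugate k j
      = if i = j then (pencil A).det else 0 := by
    intro i j
    have := congrFun (congrFun (mul_adjugate (pencil A)) i) j
    rw [pencil, add_mul, ← pencil, one_mul, smul_mul_assoc] at this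
    simpa [Matrix.mul_apply, Matrix.one_apply] using this
  induction m generalizing i j with
  | zero =>
    have := congrArg (fun p => coeff p 0) (h i j)
    simp only [coeff_add, mul_coeff_zero, coeff_X_zero, zero_mul, add_zero] at this
    rw [this, newton_zero, Matrix.one_apply]
    split_ifs
    · exact sig_zero A
    · simp
  | succ m ih =>
    have := congrArg (fun p => coeff p (m + 1)) (h i j)
    simp only [coeff_add, coeff_X_mul, finsetSum_coeff, coeff_C_mul, ih] at this
    rw [newton_succ, Matrix.sub_apply, Matrix.smul_apply, Matrix.one_apply, Matrix.mul_apply,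
      eq_sub_iff_add_eq, this]
    split_ifs
    · simp [sig]
    · simp

theorem newton_comm (m : ℕ) (A : Matrix (Fin n) (Fin n) ℝ) : A * newton m A = newton m A * A := by
  induction m with
  | zero => simp [newton_zero]
  | succ m ih =>
    rw [newton_succ, mul_sub, sub_mul, mul_smul_comm, smul_mul_assoc, mul_assoc, ← ih]; simp

theorem newton_transpose {A : Matrix (Fin n) (Fin n) ℝ} (hA : Aᵀ = A) (m : ℕ) :
    (newton m A)ᵀ = newton m A := by
  induction m with
  | zero => simp [newton_zero]
  | succ m ih =>
    rw [newton_succ, transpose_sub, transpose_mul, ih, hA, newton_comm]; simp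

theorem pencil_conj {U V : Matrix (Fin n) (Fin n) ℝ} (h : U * V = 1)
    (A : Matrix (Fin n) (Fin n) ℝ) :
    pencil (U * A * V) = U.map C * pencil A * V.map C := by
  have h1 : U.map (C : ℝ →+* ℝ[X]) * V.map C = 1 := by
    rw [← Matrix.map_mul, h, Matrix.map_one _ C.map_zero C.map_one]
  rw [pencil, pencil, mul_add, add_mul, mul_one, h1, Matrix.map_mul, Matrix.map_mul]
  simp

theorem sig_conj {U V : Matrix (Fin n) (Fin n) ℝ} (h : U * V = 1) (m : ℕ)
    (A : Matrix (Fin n) (Fin n) ℝ) : sig m (U * A * V) = sig m A := by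
  have h1 : (U.map (C : ℝ →+* ℝ[X])).det * (V.map C).det = 1 := by
    rw [← det_mul, ← Matrix.map_mul, h, Matrix.map_one _ C.map_zero C.map_one, det_one]
  rw [sig, sig, pencil_conj h, det_mul, det_mul, mul_right_comm, h1, one_mul]

theorem newton_conj {U V : Matrix (Fin n) (Fin n) ℝ} (h : U * V = 1) (m : ℕ)
    (A : Matrix (Fin n) (Fin n) ℝ) : newton m (U * A * V) = U * newton m A * V := by
  have h' : V * U = 1 := mul_eq_one_comm.1 h
  induction m with
  | zero => simp [newton_zero, h]
  | succ m ih =>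
    have e : U * A * V * (U * newton m A * V) = U * (A * newton m A) * V := by
      calc _ = U * A * (V * U) * newton m A * V := by simp only [mul_assoc]
        _ = _ := by rw [h']; simp only [mul_assoc, mul_one]
    rw [newton_succ, newton_succ, ih, sig_conj h, e, mul_sub, sub_mul, mul_smul_comm,
      smul_mul_assoc, mul_one, h]

theorem sig_diagonal (d : Fin n → ℝ) (m : ℕ) :
    sig m (diagonal d) = (Finset.univ.val.map d).esymm m := by
  have : pencil (diagonal d) = diagonal (fun i => 1 + X * C (d i)) := by
    ext1 i j
    by_cases h : i = j
    · subst h; simp [pencil]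
    · simp [pencil, h, Matrix.one_apply_ne]
  rw [sig, this, det_diagonal, ← coeff_prod_one_add, Multiset.map_map]
  rfl

theorem univ_map_eq_cons (d : Fin n → ℝ) (i : Fin n) :
    (Finset.univ.val.map d) = d i ::ₘ (((Finset.univ : Finset (Fin n)).erase i).val.map d) := by
  rw [← Multiset.map_cons, Finset.erase_val, Multiset.cons_erase (Finset.mem_univ i)]

theorem newton_diagonal (d : Fin n → ℝ) (m : ℕ) : newton m (diagonal d) =
    diagonal (fun i => ((((Finset.univ : Finset (Fin n)).erase i).val.map d)).esymm m) := by
  induction m with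
  | zero => simp [newton_zero, esymm_zero']
  | succ m ih =>
    rw [newton_succ, ih, diagonal_mul_diagonal, sig_diagonal, smul_one_eq_diagonal, diagonal_sub]
    congr 1
    ext i
    rw [univ_map_eq_cons d i, esymm_cons_succ]
    ring

theorem eigenvalues_eq {A : Matrix (Fin n) (Fin n) ℝ} (hA : A.IsHermitian) :
    eigenvalues A = Finset.univ.val.map hA.eigenvalues := by
  rw [eigenvalues, hA.roots_charpoly_eq_eigenvalues]; rfl

theorem exists_diagonalization {A : Matrix (Fin n) (Fin n) ℝ} (hA : A.IsHermitian) :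
    ∃ U : Matrix (Fin n) (Fin n) ℝ, U * Uᴴ = 1 ∧ A = U * diagonal hA.eigenvalues * Uᴴ := by
  refine ⟨hA.eigenvectorUnitary, ?_, ?_⟩
  · exact Unitary.mul_star_self_of_mem hA.eigenvectorUnitary.2
  · have := hA.spectral_theorem
    rw [Unitary.conjStarAlgAut_apply] at this
    exact this

theorem esymm_eigenvalues {A : Matrix (Fin n) (Fin n) ℝ} (hA : A.IsHermitian) (m : ℕ) :
    (eigenvalues A).esymm m = sig m A := by
  obtain ⟨U, hU, h⟩ := exists_diagonalization hA
  rw [eigenvalues_eq hA]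
  conv_rhs => rw [h, sig_conj hU, sig_diagonal]

theorem mem_gardingCone_iff {A : Matrix (Fin n) (Fin n) ℝ} (hA : A.IsHermitian) (k : ℕ) :
    eigenvalues A ∈ gardingCone k ↔ ∀ i, 1 ≤ i → i ≤ k → 0 ≤ sig i A := by
  simp only [gardingCone, Set.mem_ofPred_eq, esymm_eigenvalues hA]

/-- On Gårding's cone `Γ_{k+1}` the Newton transformations `T_0, …, T_k` are positive
semidefinite: in an eigenbasis their entries are elementary symmetric functions of the eigenvalues
with one of them deleted. -/
theorem newton_posSemidef {A : Matrix (Fin n) (Fin n) ℝ} (hA : A.IsHermitian) {k m : ℕ}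
    (h : eigenvalues A ∈ gardingCone (k + 1)) (hm : m ≤ k) : (newton m A).PosSemidef := by
  rw [eigenvalues_eq hA] at h
  obtain ⟨U, hU, hUA⟩ := exists_diagonalization hA
  rw [hUA, newton_conj hU, newton_diagonal]
  refine PosSemidef.mul_mul_conjTranspose_same (PosSemidef.diagonal ?_) U
  intro i
  rw [univ_map_eq_cons _ i] at h
  exact esymm_nonneg_of_cons _ _ k h m hm

/-- `σ_{m+1}` is affine in rank-one directions, with slope given by the Newton transformation. -/
theorem sig_add_vecMulVec (m : ℕ) (A : Matrix (Fin n) (Fin n) ℝ) (v : Fin n → ℝ) :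
    sig (m + 1) (A + vecMulVec v v) = sig (m + 1) A + v ⬝ᵥ (newton m A *ᵥ v) := by
  have key : (pencil (A + vecMulVec v v)).det = (pencil A).det +
      X * ∑ i, ∑ j, C (v i) * C (v j) * (pencil A).adjugate i j := by
    -- both sides agree after multiplication by the nonzero polynomial `det (1 + X A)`
    have h0 : ((pencil (A + vecMulVec v v)).det - ((pencil A).det +
      X * ∑ i, ∑ j, C (v i) * C (v j) * (pencil A).adjugate i j)) * (pencil A).det = 0 := by
      refine Polynomial.funext fun t => ?_
      simp only [eval_mul, eval_sub, eval_add, eval_zero, eval_X, eval_finsetSum, eval_C,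
        eval_det_pencil, eval_adjugate_pencil]
      set M := 1 + t • A with hM
      by_cases hd : M.det = 0
      · rw [hd, mul_zero]
      · have hu : IsUnit M.det := isUnit_iff_ne_zero.2 hd
        have e : 1 + t • (A + vecMulVec v v)
            = M + replicateCol Unit (t • v) * replicateRow Unit v := by
          rw [hM, smul_add, add_assoc, ← vecMulVec_eq, smul_vecMulVec]
        rw [e, det_add_replicateCol_mul_replicateRow hu, det_unique (n := Unit), Matrix.inv_def]
        simp only [Matrix.add_apply, Matrix.one_apply_eq, Matrix.mul_apply, replicateRow_apply,
          replicateCol_apply, Matrix.smul_apply, Pi.smul_apply, smul_eq_mul,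
          Ring.inverse_eq_inv']
        have : M.det * (1 + ∑ x, (∑ y, v y * (M.det⁻¹ * M.adjugate y x)) * (t * v x)) =
            M.det + t * ∑ i, ∑ j, v i * v j * M.adjugate i j := by
          rw [mul_add, mul_one, Finset.sum_comm, Finset.mul_sum, Finset.mul_sum]
          congr 1
          refine Finset.sum_congr rfl fun x _ => ?_
          rw [Finset.sum_mul, Finset.mul_sum, Finset.mul_sum]
          refine Finset.sum_congr rfl fun y _ => ?_
          field_simp
        rw [this]; ring
    rcases mul_eq_zero.1 h0 with h | h
    · exact sub_eq_zero.1 h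
    · exact absurd h (det_pencil_ne_zero A)
  rw [sig, key, coeff_add, coeff_X_mul]
  simp only [finsetSum_coeff, mul_assoc, coeff_C_mul, coeff_adjugate_pencil, sig, dotProduct,
    mulVec, Finset.mul_sum]
  congr 1
  refine Finset.sum_congr rfl fun x _ => Finset.sum_congr rfl fun y _ => by ring

theorem mem_gardingCone_add_vecMulVec {A : Matrix (Fin n) (Fin n) ℝ} (hA : A.IsHermitian) {k : ℕ}
    (h : eigenvalues A ∈ gardingCone k) (v : Fin n → ℝ) :
    (A + vecMulVec v v).IsHermitian ∧ eigenvalues (A + vecMulVec v v) ∈ gardingCone k := by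
  have hh : (A + vecMulVec v v).IsHermitian := by
    refine hA.add ?_
    ext i j
    simp [vecMulVec_apply, mul_comm]
  refine ⟨hh, (mem_gardingCone_iff hh k).2 fun i h1 h2 => ?_⟩
  obtain ⟨i, rfl⟩ := Nat.exists_eq_add_of_le' h1
  obtain ⟨k, rfl⟩ := Nat.exists_eq_add_of_le' (h1.trans h2)
  rw [sig_add_vecMulVec]
  have hp := newton_posSemidef hA h (show i ≤ k by omega)
  have := hp.dotProduct_mulVec_nonneg v
  have h3 := (mem_gardingCone_iff hA _).1 h (i + 1) h1 h2
  rw [star_trivial] at this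
  exact add_nonneg h3 this

theorem exists_eq_conjTranspose_mul {B : Matrix (Fin n) (Fin n) ℝ} (hB : B.PosSemidef) :
    ∃ M : Matrix (Fin n) (Fin n) ℝ, B = Mᴴ * M := by
  obtain ⟨U, -, hU⟩ := exists_diagonalization hB.isHermitian
  refine ⟨diagonal (fun i => √(hB.isHermitian.eigenvalues i)) * Uᴴ, ?_⟩
  conv_lhs => rw [hU]
  rw [conjTranspose_mul, conjTranspose_conjTranspose, diagonal_conjTranspose, mul_assoc,
    mul_assoc, ← mul_assoc (diagonal _) (diagonal _), diagonal_mul_diagonal]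
  congr 3
  ext i
  simp [Real.mul_self_sqrt (hB.eigenvalues_nonneg i)]

/-- The largest eigenvalue of a positive semidefinite matrix is at most its trace. -/
theorem dotProduct_mulVec_le_trace {B : Matrix (Fin n) (Fin n) ℝ} (hB : B.PosSemidef)
    (v : Fin n → ℝ) : v ⬝ᵥ (B *ᵥ v) ≤ B.trace * (v ⬝ᵥ v) := by
  obtain ⟨M, rfl⟩ := exists_eq_conjTranspose_mul hB
  have h1 : v ⬝ᵥ ((Mᴴ * M) *ᵥ v) = ∑ i, (∑ j, M i j * v j) ^ 2 := by
    rw [← mulVec_mulVec, conjTranspose_eq_transpose_of_trivial, dotProduct_mulVec,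
      vecMul_transpose]
    simp [dotProduct, mulVec, sq]
  have h2 : (Mᴴ * M).trace = ∑ i, ∑ j, M i j ^ 2 := by
    rw [Finset.sum_comm]
    simp [trace, Matrix.mul_apply, sq]
  have h3 : v ⬝ᵥ v = ∑ j, v j ^ 2 := by simp [dotProduct, sq]
  rw [h1, h2, h3, Finset.sum_mul]
  exact Finset.sum_le_sum fun i _ => Finset.sum_mul_sq_le_sq_mul_sq _ _ _

/-- Gårding's cone is stable under adding positive semidefinite matrices. -/
theorem mem_gardingCone_add_posSemidef {A B : Matrix (Fin n) (Fin n) ℝ} (hA : A.IsHermitian)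
    {k : ℕ} (h : eigenvalues A ∈ gardingCone k) (hB : B.PosSemidef) :
    eigenvalues (A + B) ∈ gardingCone k := by
  obtain ⟨M, rfl⟩ := exists_eq_conjTranspose_mul hB
  have e : Mᴴ * M = ∑ i, vecMulVec (M i) (M i) := by
    ext a b
    simp [Matrix.mul_apply, Matrix.sum_apply, vecMulVec_apply]
  have key : ∀ s : Finset (Fin n), (A + ∑ i ∈ s, vecMulVec (M i) (M i)).IsHermitian ∧
      eigenvalues (A + ∑ i ∈ s, vecMulVec (M i) (M i)) ∈ gardingCone k := by
    intro s
    induction s using Finset.induction_on with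
    | empty => simpa using ⟨hA, h⟩
    | insert a s ha ih =>
      rw [Finset.sum_insert ha, add_comm (vecMulVec _ _), ← add_assoc]
      exact mem_gardingCone_add_vecMulVec ih.1 ih.2 _
  rw [e]
  exact (key _).2

end

/-! ### Derivatives of the Newton transformations -/

section

open Polynomial Matrix

variable {n : ℕ}

/-- Jacobi's formula for the derivative of a determinant. -/
theorem hasDerivAt_det {M : ℝ → Matrix (Fin n) (Fin n) ℝ} {M' : Matrix (Fin n) (Fin n) ℝ} {s : ℝ}
    (hM : ∀ i j, HasDerivAt (fun t => M t i j) (M' i j) s) :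
    HasDerivAt (fun t => (M t).det) ((M s).adjugate * M').trace s := by
  have h1 : HasDerivAt (fun t => (M t).det) (∑ σ : Equiv.Perm (Fin n),
      ((Equiv.Perm.sign σ : ℤ) : ℝ) * ∑ i, (∏ j ∈ Finset.univ.erase i, M s (σ j) j) • M' (σ i) i)
      s := by
    simp only [det_apply']
    refine HasDerivAt.fun_sum fun σ _ => HasDerivAt.const_mul _ ?_
    exact HasDerivAt.fun_finsetProd fun i _ => hM (σ i) i
  convert h1 using 1
  have h2 : ((M s).adjugate * M').trace = ∑ i, ((M s).updateCol i (fun j => M' j i)).det := by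
    simp only [← cramer_apply, cramer_eq_adjugate_mulVec]
    simp [trace, Matrix.mul_apply, mulVec, dotProduct]
  rw [h2]
  simp only [det_apply', Finset.mul_sum]
  rw [Finset.sum_comm]
  refine Finset.sum_congr rfl fun σ _ => Finset.sum_congr rfl fun i _ => ?_
  rw [← Finset.mul_prod_erase _ _ (Finset.mem_univ i), updateCol_self, smul_eq_mul,
    mul_comm (M' (σ i) i)]
  congr 2
  refine Finset.prod_congr rfl fun j hj => ?_
  rw [updateCol_ne (Finset.ne_of_mem_erase hj)]

/-- Jacobi's formula along `t ↦ 1 + t A` gives `tr (T_m A) = (m + 1) σ_{m+1}`. -/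
theorem trace_newton_mul (m : ℕ) (A : Matrix (Fin n) (Fin n) ℝ) :
    (newton m A * A).trace = (m + 1) * sig (m + 1) A := by
  have h : derivative (pencil A).det = ∑ i, ∑ j, (pencil A).adjugate i j * C (A j i) := by
    refine Polynomial.funext fun t => ?_
    have h1 : HasDerivAt (fun t => (1 + t • A).det) ((1 + t • A).adjugate * A).trace t := by
      refine hasDerivAt_det fun i j => ?_
      simpa using ((hasDerivAt_id t).mul_const (A i j)).const_add ((1 : Matrix _ _ ℝ) i j)
    have h2 := (pencil A).det.hasDerivAt t
    simp only [eval_det_pencil] at h2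
    rw [h2.unique h1]
    simp [trace, Matrix.mul_apply, eval_finsetSum, eval_adjugate_pencil]
  have h3 := congrArg (fun p => coeff p m) h
  simp only [coeff_derivative, finsetSum_coeff, coeff_mul_C, coeff_adjugate_pencil] at h3
  rw [mul_comm, sig, h3]
  simp [trace, Matrix.mul_apply]

theorem trace_newton (m : ℕ) (A : Matrix (Fin n) (Fin n) ℝ) :
    (newton m A).trace = (n - m) * sig m A := by
  cases m with
  | zero => simp [newton_zero, sig_zero]
  | succ m =>
    rw [newton_succ, trace_sub, newton_comm, trace_newton_mul, trace_smul, trace_one]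
    simp
    ring

theorem sig_succ (m : ℕ) (A : Matrix (Fin n) (Fin n) ℝ) :
    sig (m + 1) A = (∑ i, ∑ j, newton m A i j * A j i) / (m + 1) := by
  have := trace_newton_mul m A
  have h : (m + 1 : ℝ) ≠ 0 := by positivity
  rw [eq_div_iff h, mul_comm, ← this]
  simp [trace, Matrix.mul_apply]

theorem newton_succ_apply (m : ℕ) (A : Matrix (Fin n) (Fin n) ℝ) (i j : Fin n) :
    newton (m + 1) A i j = sig (m + 1) A * (1 : Matrix (Fin n) (Fin n) ℝ) i j
      - ∑ q, newton m A i q * A q j := by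
  rw [newton_succ, newton_comm]
  simp [Matrix.mul_apply]

/-- The derivative of `T_m` at `A` in the direction `B`. -/
noncomputable def dnewton : ℕ → Matrix (Fin n) (Fin n) ℝ → Matrix (Fin n) (Fin n) ℝ →
    Matrix (Fin n) (Fin n) ℝ
  | 0, _, _ => 0
  | m + 1, A, B => (newton m A * B).trace • (1 : Matrix (Fin n) (Fin n) ℝ)
      - (dnewton m A B * A + newton m A * B)

/-- Along a curve of matrices, `σ_{m+1}' = tr (T_m A')`. -/
theorem hasDerivAt_sig_newton {A : ℝ → Matrix (Fin n) (Fin n) ℝ} {B : Matrix (Fin n) (Fin n) ℝ}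
    {s : ℝ} (hA : ∀ i j, HasDerivAt (fun t => A t i j) (B i j) s) (m : ℕ) :
    HasDerivAt (fun t => sig (m + 1) (A t)) (newton m (A s) * B).trace s ∧
    ∀ i j, HasDerivAt (fun t => newton m (A t) i j) (dnewton m (A s) B i j) s := by
  -- the recursion shows that all `σ_m(A(t))` are differentiable
  have hd : ∀ m, (∀ i j, DifferentiableAt ℝ (fun t => newton m (A t) i j) s) ∧
      DifferentiableAt ℝ (fun t => sig m (A t)) s := by
    intro m
    induction m with
    | zero => simp [newton_zero, sig_zero]
    | succ m ih =>
      have h1 : DifferentiableAt ℝ (fun t => sig (m + 1) (A t)) s := by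
        simp only [sig_succ]
        refine DifferentiableAt.div_const (DifferentiableAt.fun_sum fun i _ =>
          DifferentiableAt.fun_sum fun j _ => (ih.1 i j).mul (hA j i).differentiableAt) _
      refine ⟨fun i j => ?_, h1⟩
      simp only [newton_succ_apply]
      exact (h1.mul_const _).sub (DifferentiableAt.fun_sum fun q _ =>
        (ih.1 i q).mul (hA q j).differentiableAt)
  have hs : ∀ m, HasDerivAt (fun t => sig (m + 1) (A t)) (newton m (A s) * B).trace s := by
    -- compare coefficients of `t` in Jacobi's formula for `det (1 + t A(s))`
    have hpoly : ∑ m ∈ Finset.range (n + 1), C (deriv (fun r => sig m (A r)) s) * X ^ m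
        = X * ∑ i, ∑ j, (pencil (A s)).adjugate i j * C (B j i) := by
      refine Polynomial.funext fun t => ?_
      have h1 : HasDerivAt (fun r => (1 + t • A r).det)
          ((1 + t • A s).adjugate * (t • B)).trace s := by
        refine hasDerivAt_det fun i j => ?_
        simpa using ((hA i j).const_mul t).const_add ((1 : Matrix _ _ ℝ) i j)
      have h2 : HasDerivAt (fun r => (1 + t • A r).det)
          (∑ m ∈ Finset.range (n + 1), deriv (fun r => sig m (A r)) s * t ^ m) s := by
        have e : (fun r => (1 + t • A r).det)
            = fun r => ∑ m ∈ Finset.range (n + 1), sig m (A r) * t ^ m := by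
          funext r
          rw [← eval_det_pencil, eval_eq_sum_range'
            (Nat.lt_succ_of_le (natDegree_det_pencil_le (A r)))]
          rfl
        rw [e]
        exact HasDerivAt.fun_sum fun m _ => ((hd m).2.hasDerivAt).mul_const _
      have h3 := h2.unique h1
      simp only [eval_finsetSum, eval_mul, eval_C, eval_pow, eval_X, h3, eval_adjugate_pencil]
      simp [trace, Matrix.mul_apply, Finset.mul_sum]
    intro m
    have hc := congrArg (fun p => coeff p (m + 1)) hpoly
    simp only [coeff_X_mul, finsetSum_coeff, coeff_mul_C, coeff_adjugate_pencil, coeff_C_mul,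
      coeff_X_pow] at hc
    have ht : (newton m (A s) * B).trace = deriv (fun r => sig (m + 1) (A r)) s := by
      have e : (newton m (A s) * B).trace = ∑ i, ∑ j, newton m (A s) i j * B j i := by
        simp [trace, Matrix.mul_apply]
      rw [e, ← hc]
      by_cases hm : m + 1 < n + 1
      · simp [hm]
      · have hz : (fun r => sig (m + 1) (A r)) = fun _ => 0 := by
          funext r
          exact coeff_eq_zero_of_natDegree_lt
            (lt_of_le_of_lt (natDegree_det_pencil_le (A r)) (by omega))
        rw [hz]
        simp [hm]
    rw [ht]
    exact (hd (m + 1)).2.hasDerivAt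
  refine ⟨hs m, ?_⟩
  induction m with
  | zero =>
    intro i j
    simpa [newton_zero, dnewton] using hasDerivAt_const s _
  | succ m ih =>
    intro i j
    simp only [newton_succ_apply]
    refine HasDerivAt.congr_deriv (((hs m).mul_const ((1 : Matrix (Fin n) (Fin n) ℝ) i j)).fun_sub
      (HasDerivAt.fun_sum (u := Finset.univ) fun q _ => (ih i q).fun_mul (hA q j))) ?_
    simp [dnewton, Matrix.mul_apply, Finset.sum_add_distrib]

/-- The Codazzi equation satisfied by `A(u)` turns into the divergence identity
`u ∂_i T_m^{ij} = n T_m^{ij} u_i - (n - m) σ_m u_j`. -/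
theorem div_newton_of_codazzi {A : Matrix (Fin n) (Fin n) ℝ} (hA : Aᵀ = A)
    {dA : Fin n → Matrix (Fin n) (Fin n) ℝ} (hdA : ∀ l, (dA l)ᵀ = dA l) (u : ℝ) (p : Fin n → ℝ)
    (hC : ∀ l i j, u * (dA l i j - dA i l j) = p l * A i j - p i * A l j
      - (A *ᵥ p) l * (1 : Matrix (Fin n) (Fin n) ℝ) i j
      + (A *ᵥ p) i * (1 : Matrix (Fin n) (Fin n) ℝ) l j) (m : ℕ) (j : Fin n) :
    u * ∑ i, dnewton m A (dA i) i j
      = n * (newton m A *ᵥ p) j - (n - m) * sig m A * p j := by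
  induction m generalizing j with
  | zero => simp [dnewton, newton_zero, sig_zero]
  | succ m ih =>
    have hT := newton_transpose hA m
    have hTs : ∀ a b, newton m A a b = newton m A b a := fun a b => congrFun (congrFun hT b) a
    have hds : ∀ l a b, dA l a b = dA l b a := fun l a b => congrFun (congrFun (hdA l) b) a
    set T := newton m A with hTdef
    -- the contribution of the Codazzi tensor
    have e1 : u * ((T * dA j).trace - ∑ i, (T * dA i) i j)
        = p j * (T * A).trace - (A *ᵥ p) j * T.trace := by
      have e2 : (T * dA j).trace - ∑ i, (T * dA i) i j
          = ∑ i, ∑ q, T i q * (dA j i q - dA i j q) := by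
        simp only [trace, Matrix.mul_apply, Matrix.diag_apply, ← Finset.sum_sub_distrib]
        refine Finset.sum_congr rfl fun i _ => Finset.sum_congr rfl fun q _ => ?_
        rw [hds j q i, hds i q j]; ring
      have e3 : u * ∑ i, ∑ q, T i q * (dA j i q - dA i j q)
          = ∑ i, ∑ q, (p j * (T i q * A q i) - A j q * (T q i * p i)
            - (A *ᵥ p) j * (T i q * (1 : Matrix (Fin n) (Fin n) ℝ) i q)
            + T i q * (A *ᵥ p) i * (1 : Matrix (Fin n) (Fin n) ℝ) j q) := by
        simp only [Finset.mul_sum]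
        refine Finset.sum_congr rfl fun i _ => Finset.sum_congr rfl fun q _ => ?_
        have hAs : A q i = A i q := congrFun (congrFun hA i) q
        rw [hTs q i, hAs]
        linear_combination (T i q) * hC j i q
      have e4 : ∑ i, ∑ q, A j q * (T q i * p i) = (A *ᵥ (T *ᵥ p)) j := by
        rw [Finset.sum_comm]
        simp [mulVec, dotProduct, Finset.mul_sum]
      have e5 : ∑ i, ∑ q, T i q * (A *ᵥ p) i * (1 : Matrix (Fin n) (Fin n) ℝ) j q
          = (T *ᵥ (A *ᵥ p)) j := by
        simp only [Matrix.one_apply, mul_ite, mul_one, mul_zero, Finset.sum_ite_eq,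
          Finset.mem_univ, if_true]
        rw [mulVec, dotProduct]
        exact Finset.sum_congr rfl fun i _ => by rw [hTs i j]
      rw [e2, e3]
      simp only [Finset.sum_add_distrib, Finset.sum_sub_distrib, ← Finset.mul_sum]
      rw [show ∑ i, ∑ q, A j q * (T q i * p i) = (A *ᵥ (T *ᵥ p)) j from e4, e5]
      have e6 : (T *ᵥ (A *ᵥ p)) = (A *ᵥ (T *ᵥ p)) := by
        rw [mulVec_mulVec, mulVec_mulVec, hTdef, newton_comm]
      rw [e6]
      simp [trace, Matrix.mul_apply, Matrix.one_apply]
      ring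
    have e7 : u * ∑ i, (dnewton m A (dA i) * A) i j = n * (A *ᵥ (T *ᵥ p)) j
        - (n - m) * sig m A * (A *ᵥ p) j := by
      have : ∑ i, (dnewton m A (dA i) * A) i j
          = ∑ q, A j q * ∑ i, dnewton m A (dA i) i q := by
        simp only [Matrix.mul_apply, Finset.mul_sum]
        rw [Finset.sum_comm]
        refine Finset.sum_congr rfl fun q _ => Finset.sum_congr rfl fun i _ => ?_
        have hAs : A q j = A j q := congrFun (congrFun hA j) q
        rw [hAs, mul_comm]
      rw [this, Finset.mul_sum]
      have h8 : ∀ q, u * (A j q * ∑ i, dnewton m A (dA i) i q)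
          = A j q * (n * (T *ᵥ p) q - (n - m) * sig m A * p q) := by
        intro q
        rw [← ih q]; ring
      simp only [h8, mul_sub, Finset.sum_sub_distrib]
      rw [mulVec, mulVec, dotProduct, dotProduct, Finset.mul_sum, Finset.mul_sum]
      congr 1 <;> exact Finset.sum_congr rfl fun q _ => by ring
    have e9 : ∑ i, dnewton (m + 1) A (dA i) i j
        = (T * dA j).trace - ∑ i, (T * dA i) i j - ∑ i, (dnewton m A (dA i) * A) i j := by
      simp only [dnewton, Matrix.sub_apply, Matrix.smul_apply, Matrix.add_apply, ← hTdef,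
        Finset.sum_sub_distrib, Finset.sum_add_distrib, Matrix.one_apply, smul_eq_mul, mul_ite,
        mul_one, mul_zero, Finset.sum_ite_eq', Finset.mem_univ, if_true]
      ring
    have e10 : (newton (m + 1) A *ᵥ p) j = sig (m + 1) A * p j - (A *ᵥ (T *ᵥ p)) j := by
      rw [newton_succ, sub_mulVec, mulVec_mulVec]
      simp [smul_mulVec]
      rfl
    rw [e9, mul_sub, e1, e7, e10, trace_newton_mul, trace_newton]
    push_cast
    ring

end

/-! ### The pointwise divergence formula -/

section

open Polynomial Matrix

variable {n : ℕ}

/-- The vector of first partial derivatives of `u` at `x`. -/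
noncomputable def grad (u : EuclideanSpace ℝ (Fin n) → ℝ) (x : EuclideanSpace ℝ (Fin n)) :
    Fin n → ℝ :=
  fun i => fderiv ℝ u x (EuclideanSpace.single i 1)

theorem gradient_apply (u : EuclideanSpace ℝ (Fin n) → ℝ) (x : EuclideanSpace ℝ (Fin n))
    (i : Fin n) : gradient u x i = grad u x i := by
  rw [grad, ← inner_gradient_left (𝕜 := ℝ)]
  simp only [EuclideanSpace.inner_single_right, one_mul, conj_trivial]

theorem norm_gradient_sq (u : EuclideanSpace ℝ (Fin n) → ℝ) (x : EuclideanSpace ℝ (Fin n)) :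
    ‖gradient u x‖ ^ 2 = grad u x ⬝ᵥ grad u x := by
  rw [EuclideanSpace.norm_sq_eq]
  simp [gradient_apply, dotProduct, sq]

/-- The matrix `A` as a function of the 2-jet `(s, p, H)` of `u` at a point. -/
noncomputable def jetA (s : ℝ) (p : Fin n → ℝ) (H : Matrix (Fin n) (Fin n) ℝ) :
    Matrix (Fin n) (Fin n) ℝ :=
  s • H - ((1 / 2 : ℝ) * (p ⬝ᵥ p)) • (1 : Matrix (Fin n) (Fin n) ℝ)

theorem schouten_eq_jetA (u : EuclideanSpace ℝ (Fin n) → ℝ) (x : EuclideanSpace ℝ (Fin n)) :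
    schouten u x = jetA (u x) (grad u x) (hessian u x) := by
  rw [schouten, jetA, norm_gradient_sq]

/-- The divergence of the vector field `ζ u^{α+1} |∇u|^{2l} T_i(A(u)) ∇u`, as a function of the
1-jet `(z, q)` of `ζ` and of the 2-jet `(s, p, H)` of `u`. The third derivatives of `u` cancel. -/
noncomputable def flux (α : ℝ) (l i : ℕ) (z : ℝ) (q : Fin n → ℝ) (s : ℝ) (p : Fin n → ℝ)
    (H : Matrix (Fin n) (Fin n) ℝ) : ℝ :=
  (q ⬝ᵥ (newton i (jetA s p H) *ᵥ p)) * s ^ (α + 1) * (p ⬝ᵥ p) ^ l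
  + z * s ^ α * ((i + 1 + 2 * l) * (p ⬝ᵥ p) ^ l * sig (i + 1) (jetA s p H)
    - (n - i) / 2 * (p ⬝ᵥ p) ^ (l + 1) * sig i (jetA s p H)
    + (α + 1 + n + l) * (p ⬝ᵥ p) ^ l * (p ⬝ᵥ (newton i (jetA s p H) *ᵥ p))
    - 2 * l * (p ⬝ᵥ p) ^ (l - 1) * (p ⬝ᵥ (newton (i + 1) (jetA s p H) *ᵥ p)))

/-- The pointwise computation behind the divergence formula: `D l i j` stands for the third
derivatives of the function with 2-jet `(s, p, H)`. -/
theorem flux_eq (α : ℝ) (l i : ℕ) (z : ℝ) (q : Fin n → ℝ) {s : ℝ} (hs : 0 < s) (p : Fin n → ℝ)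
    {H : Matrix (Fin n) (Fin n) ℝ} (hH : Hᵀ = H) {D : Fin n → Matrix (Fin n) (Fin n) ℝ}
    (hD : ∀ l, (D l)ᵀ = D l) (hD' : ∀ l i j, D l i j = D i l j) :
    ∑ k, ((q k * s ^ (α + 1) * (p ⬝ᵥ p) ^ l + z * ((α + 1) * s ^ α * p k) * (p ⬝ᵥ p) ^ l
        + z * s ^ (α + 1) * (l * (p ⬝ᵥ p) ^ (l - 1) * (2 * (H *ᵥ p) k)))
          * (newton i (jetA s p H) *ᵥ p) k
      + z * s ^ (α + 1) * (p ⬝ᵥ p) ^ l * ∑ j, (dnewton i (jetA s p H)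
          (p k • H + s • D k - (H *ᵥ p) k • (1 : Matrix (Fin n) (Fin n) ℝ)) k j * p j
          + newton i (jetA s p H) k j * H k j))
      = flux α l i z q s p H := by
  set A := jetA s p H with hAdef
  set T := newton i A with hT
  set P := p ⬝ᵥ p with hP
  set dA : Fin n → Matrix (Fin n) (Fin n) ℝ := fun k =>
    p k • H + s • D k - (H *ᵥ p) k • (1 : Matrix (Fin n) (Fin n) ℝ) with hdA
  have hA : Aᵀ = A := by simp [hAdef, jetA, hH]
  have hdAs : ∀ l, (dA l)ᵀ = dA l := fun l => by simp [hdA, hH, hD]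
  have hAij : ∀ a b, s * H a b = A a b + 1 / 2 * P * (1 : Matrix (Fin n) (Fin n) ℝ) a b := by
    intro a b; simp [hAdef, jetA, hP]
  have hAp : ∀ a, s * (H *ᵥ p) a = (A *ᵥ p) a + 1 / 2 * P * p a := by
    intro a
    simp only [hAdef, jetA, sub_mulVec, smul_mulVec, one_mulVec, Pi.sub_apply, Pi.smul_apply,
      smul_eq_mul, hP]
    ring
  have hC : ∀ l i j, s * (dA l i j - dA i l j) = p l * A i j - p i * A l j
      - (A *ᵥ p) l * (1 : Matrix (Fin n) (Fin n) ℝ) i j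
      + (A *ᵥ p) i * (1 : Matrix (Fin n) (Fin n) ℝ) l j := by
    intro l i j
    simp only [hdA, Matrix.sub_apply, Matrix.add_apply, Matrix.smul_apply, smul_eq_mul]
    rw [hD' l i j]
    linear_combination p l * hAij i j - p i * hAij l j
      - (1 : Matrix (Fin n) (Fin n) ℝ) i j * hAp l + (1 : Matrix (Fin n) (Fin n) ℝ) l j * hAp i
  have hdiv := div_newton_of_codazzi hA hdAs s p hC i
  -- the divergence of `T ∇u`, multiplied by `u`
  have h1 : s * ∑ k, ∑ j, (dnewton i A (dA k) k j * p j + T k j * H k j)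
      = n * (p ⬝ᵥ (T *ᵥ p)) - (n - i) * sig i A * P
        + ((i + 1) * sig (i + 1) A + 1 / 2 * P * ((n - i) * sig i A)) := by
    have h2 : s * ∑ k, ∑ j, dnewton i A (dA k) k j * p j
        = n * (p ⬝ᵥ (T *ᵥ p)) - (n - i) * sig i A * P := by
      rw [Finset.sum_comm]
      have : s * ∑ j, ∑ k, dnewton i A (dA k) k j * p j
          = ∑ j, p j * (s * ∑ k, dnewton i A (dA k) k j) := by
        rw [Finset.mul_sum]
        refine Finset.sum_congr rfl fun j _ => ?_
        rw [← Finset.sum_mul]; ring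
      rw [this]
      simp only [hdiv, hP, dotProduct, Finset.mul_sum, ← Finset.sum_sub_distrib]
      refine Finset.sum_congr rfl fun j _ => ?_
      rw [mul_sub]
      ring
    have h3 : s * ∑ k, ∑ j, T k j * H k j
        = (i + 1) * sig (i + 1) A + 1 / 2 * P * ((n - i) * sig i A) := by
      rw [← trace_newton_mul, ← trace_newton]
      simp only [Finset.mul_sum, trace, Matrix.diag_apply, Matrix.mul_apply]
      rw [← Finset.sum_add_distrib]
      refine Finset.sum_congr rfl fun k _ => ?_
      have : ∀ j, s * (T k j * H k j) = T k j * A j k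
          + 1 / 2 * P * (T k j * (1 : Matrix (Fin n) (Fin n) ℝ) k j) := by
        intro j
        have hs' : A j k = A k j := congrFun (congrFun hA k) j
        rw [hs']
        linear_combination T k j * hAij k j
      simp only [this, Finset.sum_add_distrib, ← Finset.mul_sum]
      simp [Matrix.one_apply, hT]
    simp only [Finset.sum_add_distrib, mul_add, h2, h3]
  have h4 : ∑ k, (s * (H *ᵥ p) k) * (T *ᵥ p) k
      = sig (i + 1) A * P - p ⬝ᵥ (newton (i + 1) A *ᵥ p) + 1 / 2 * P * (p ⬝ᵥ (T *ᵥ p)) := by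
    simp only [hAp, add_mul, Finset.sum_add_distrib]
    have e1 : ∑ k, (A *ᵥ p) k * (T *ᵥ p) k = p ⬝ᵥ ((A * T) *ᵥ p) := by
      rw [← mulVec_mulVec]
      change (A *ᵥ p) ⬝ᵥ (T *ᵥ p) = _
      rw [← vecMul_transpose, hA, dotProduct_mulVec, dotProduct_mulVec, dotProduct_mulVec]
    have e2 : A * T = sig (i + 1) A • (1 : Matrix (Fin n) (Fin n) ℝ) - newton (i + 1) A := by
      rw [newton_succ]; simp [hT]
    rw [e1, e2, sub_mulVec, dotProduct_sub, smul_mulVec, one_mulVec, dotProduct_smul, smul_eq_mul]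
    congr 1
    rw [dotProduct, Finset.mul_sum]
    exact Finset.sum_congr rfl fun k _ => by ring
  have hpow : s ^ (α + 1) = s ^ α * s := by rw [Real.rpow_add hs, Real.rpow_one]
  have hl : (l : ℝ) * P ^ (l - 1) * P = l * P ^ l := by
    cases l with
    | zero => simp
    | succ l => simp [pow_succ, mul_assoc]
  have hq : ∑ k, q k * (T *ᵥ p) k = q ⬝ᵥ (T *ᵥ p) := rfl
  have hp : ∑ k, p k * (T *ᵥ p) k = p ⬝ᵥ (T *ᵥ p) := rfl
  have hsum : ∑ k, ((q k * s ^ (α + 1) * P ^ l + z * ((α + 1) * s ^ α * p k) * P ^ l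
        + z * s ^ (α + 1) * (l * P ^ (l - 1) * (2 * (H *ᵥ p) k))) * (T *ᵥ p) k
      + z * s ^ (α + 1) * P ^ l * ∑ j, (dnewton i A (dA k) k j * p j + T k j * H k j))
      = s ^ (α + 1) * P ^ l * ∑ k, q k * (T *ᵥ p) k
        + z * (α + 1) * s ^ α * P ^ l * ∑ k, p k * (T *ᵥ p) k
        + z * s ^ α * (l * P ^ (l - 1) * 2) * ∑ k, (s * (H *ᵥ p) k) * (T *ᵥ p) k
        + z * s ^ α * P ^ l * (s * ∑ k, ∑ j, (dnewton i A (dA k) k j * p j + T k j * H k j)) := by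
    simp only [Finset.mul_sum (s := Finset.univ) (a := s), hpow]
    rw [Finset.mul_sum, Finset.mul_sum, Finset.mul_sum, Finset.mul_sum, ← Finset.sum_add_distrib,
      ← Finset.sum_add_distrib, ← Finset.sum_add_distrib]
    refine Finset.sum_congr rfl fun k _ => ?_
    rw [← Finset.mul_sum]
    ring
  rw [hsum, h1, h4, hq, hp, flux, ← hAdef, ← hT, ← hP]
  linear_combination (z * s ^ α * (2 * sig (i + 1) A + p ⬝ᵥ (T *ᵥ p))) * hl

end

/-! ### The integrated divergence formula for smooth functions -/

section

open Matrix

variable {n : ℕ}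

theorem contDiff_newton_sig {F : Type*} [NormedAddCommGroup F] [NormedSpace ℝ F] {r : WithTop ℕ∞}
    {A : F → Matrix (Fin n) (Fin n) ℝ} (hA : ∀ i j, ContDiff ℝ r (fun x => A x i j)) (m : ℕ) :
    (∀ i j, ContDiff ℝ r (fun x => newton m (A x) i j)) ∧ ContDiff ℝ r (fun x => sig m (A x)) := by
  induction m with
  | zero => simp [newton_zero, sig_zero, contDiff_const]
  | succ m ih =>
    have h1 : ContDiff ℝ r (fun x => sig (m + 1) (A x)) := by
      simp only [sig_succ]
      exact (ContDiff.sum fun i _ => ContDiff.sum fun j _ => (ih.1 i j).mul (hA j i)).div_const _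
    refine ⟨fun i j => ?_, h1⟩
    simp only [newton_succ_apply]
    exact (h1.mul contDiff_const).sub (ContDiff.sum fun q _ => (ih.1 i q).mul (hA q j))

theorem continuous_newton_sig (m : ℕ) :
    Continuous (newton m : Matrix (Fin n) (Fin n) ℝ → Matrix (Fin n) (Fin n) ℝ) ∧
    Continuous (sig m : Matrix (Fin n) (Fin n) ℝ → ℝ) := by
  induction m with
  | zero =>
    refine ⟨continuous_const, ?_⟩
    rw [show (sig 0 : Matrix (Fin n) (Fin n) ℝ → ℝ) = fun _ => 1 from funext sig_zero]
    exact continuous_const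
  | succ m ih =>
    have h0 := ih.1
    have h1 : Continuous (sig (m + 1) : Matrix (Fin n) (Fin n) ℝ → ℝ) := by
      simp only [funext (sig_succ (n := n) m)]
      refine Continuous.div_const (continuous_finsetSum _ fun i _ =>
        continuous_finsetSum _ fun j _ => ?_) _
      exact (h0.matrix_elem i j).mul (continuous_id.matrix_elem j i)
    exact ⟨(h1.smul continuous_const).sub (continuous_id.matrix_mul h0), h1⟩

theorem hasDerivAt_line {F : Type*} [NormedAddCommGroup F] [NormedSpace ℝ F]
    {f : EuclideanSpace ℝ (Fin n) → F} {x : EuclideanSpace ℝ (Fin n)} (hf : DifferentiableAt ℝ f x)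
    (w : EuclideanSpace ℝ (Fin n)) :
    HasDerivAt (fun t : ℝ => f (x + t • w)) (fderiv ℝ f x w) 0 :=
  (hf.hasFDerivAt.hasLineDerivAt w)

theorem hasDerivAt_grad_line {v : EuclideanSpace ℝ (Fin n) → ℝ} {x : EuclideanSpace ℝ (Fin n)}
    (hv : DifferentiableAt ℝ (fderiv ℝ v) x) (k i : Fin n) :
    HasDerivAt (fun t : ℝ => grad v (x + t • EuclideanSpace.single k 1) i) (hessian v x k i) 0 := by
  have h := (hasDerivAt_line hv (EuclideanSpace.single k 1)).clm_apply
    (hasDerivAt_const (0 : ℝ) (EuclideanSpace.single i (1 : ℝ)))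
  simpa [grad, hessian] using h

/-- Evaluation of a second derivative at a pair of coordinate vectors. -/
noncomputable def hessianEntry (i j : Fin n) :
    (EuclideanSpace ℝ (Fin n) →L[ℝ] EuclideanSpace ℝ (Fin n) →L[ℝ] ℝ) →L[ℝ] ℝ :=
  (ContinuousLinearMap.apply ℝ ℝ (EuclideanSpace.single j (1 : ℝ))).comp
    (ContinuousLinearMap.apply ℝ (EuclideanSpace ℝ (Fin n) →L[ℝ] ℝ)
      (EuclideanSpace.single i (1 : ℝ)))

theorem hasDerivAt_hessian_line {v : EuclideanSpace ℝ (Fin n) → ℝ} {x : EuclideanSpace ℝ (Fin n)}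
    (hv : DifferentiableAt ℝ (fderiv ℝ (fderiv ℝ v)) x) (k i j : Fin n) :
    HasDerivAt (fun t : ℝ => hessian v (x + t • EuclideanSpace.single k 1) i j)
      (fderiv ℝ (fderiv ℝ (fderiv ℝ v)) x (EuclideanSpace.single k 1) (EuclideanSpace.single i 1)
        (EuclideanSpace.single j 1)) 0 := by
  exact (hessianEntry i j).hasFDerivAt.comp_hasDerivAt (0 : ℝ) (hasDerivAt_line
    (F := EuclideanSpace ℝ (Fin n) →L[ℝ] EuclideanSpace ℝ (Fin n) →L[ℝ] ℝ) hv
    (EuclideanSpace.single k 1))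

theorem hessian_transpose {v : EuclideanSpace ℝ (Fin n) → ℝ} {x : EuclideanSpace ℝ (Fin n)}
    (hv : ContDiffAt ℝ 2 v x) : (hessian v x)ᵀ = hessian v x := by
  ext i j
  exact (hv.isSymmSndFDerivAt (by simp)) _ _

theorem contDiff_grad {v : EuclideanSpace ℝ (Fin n) → ℝ} {r : WithTop ℕ∞}
    (hv : ContDiff ℝ (r + 1) v) (i : Fin n) : ContDiff ℝ r (fun x => grad v x i) :=
  (hv.fderiv_right le_rfl).clm_apply contDiff_const

theorem contDiff_hessian {v : EuclideanSpace ℝ (Fin n) → ℝ} {r : WithTop ℕ∞}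
    (hv : ContDiff ℝ (r + 1 + 1) v) (i j : Fin n) : ContDiff ℝ r (fun x => hessian v x i j) :=
  (((hv.fderiv_right le_rfl).fderiv_right le_rfl).clm_apply contDiff_const).clm_apply
    contDiff_const

theorem integral_fderiv_eq_zero {f : EuclideanSpace ℝ (Fin n) → ℝ} (hf : ContDiff ℝ 1 f)
    (hc : HasCompactSupport f) (w : EuclideanSpace ℝ (Fin n)) :
    Integrable (fun x => fderiv ℝ f x w) ∧ ∫ x, fderiv ℝ f x w = 0 := by
  have hi : Integrable (fun x => fderiv ℝ f x w) :=
    ((hf.continuous_fderiv (by simp)).clm_apply continuous_const).integrable_of_hasCompactSupport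
      (hc.fderiv_apply ℝ w)
  refine ⟨hi, ?_⟩
  have := integral_mul_fderiv_eq_neg_fderiv_mul_of_integrable (μ := volume)
    (f := fun _ : EuclideanSpace ℝ (Fin n) => (1 : ℝ)) (g := f) (v := w) (by simp)
    (by simpa using hi) (by simpa using hf.continuous.integrable_of_hasCompactSupport hc)
    (fun x _ => by fun_prop) (fun x _ => hf.differentiable (by simp) x)
  simpa using this

/-- The divergence formula for smooth positive functions. -/
theorem integral_flux_smooth (α : ℝ) (l i : ℕ) {v ζ : EuclideanSpace ℝ (Fin n) → ℝ}
    (hv : ContDiff ℝ 3 v) (hpos : ∀ x, 0 < v x) (hζ : ContDiff ℝ 1 ζ) (hc : HasCompactSupport ζ) :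
    ∫ x, flux α l i (ζ x) (grad ζ x) (v x) (grad v x) (hessian v x) = 0 := by
  set A : EuclideanSpace ℝ (Fin n) → Matrix (Fin n) (Fin n) ℝ :=
    fun x => jetA (v x) (grad v x) (hessian v x) with hAdef
  have hv3 : ContDiff ℝ (1 + 1 + 1) v := hv.of_le (by norm_num)
  have hv1 : ContDiff ℝ 1 v := hv.of_le (by norm_num)
  have hH := contDiff_hessian hv3
  have hG : ∀ i, ContDiff ℝ 1 (fun x => grad v x i) :=
    fun i => (contDiff_grad hv3 i).of_le (by norm_num)
  have hP : ContDiff ℝ 1 (fun x => grad v x ⬝ᵥ grad v x) :=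
    ContDiff.sum fun i _ => (hG i).mul (hG i)
  have hA : ∀ i j, ContDiff ℝ 1 (fun x => A x i j) := by
    intro i j
    simp only [hAdef, jetA, Matrix.sub_apply, Matrix.smul_apply, smul_eq_mul]
    exact (hv1.mul (hH i j)).sub ((contDiff_const.mul hP).mul contDiff_const)
  have hT := (contDiff_newton_sig hA i).1
  set W : Fin n → EuclideanSpace ℝ (Fin n) → ℝ :=
    fun k x => (newton i (A x) *ᵥ grad v x) k with hW
  have hWc : ∀ k, ContDiff ℝ 1 (W k) := fun k =>
    ContDiff.sum (s := Finset.univ) fun j _ => (hT k j).mul (hG j)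
  set V : Fin n → EuclideanSpace ℝ (Fin n) → ℝ :=
    fun k x => ζ x * v x ^ (α + 1) * (grad v x ⬝ᵥ grad v x) ^ l * W k x with hV
  have hVc : ∀ k, ContDiff ℝ 1 (V k) := fun k =>
    ((hζ.mul (hv1.rpow_const_of_ne fun x => (hpos x).ne')).mul (hP.pow l)).mul (hWc k)
  have hVs : ∀ k, HasCompactSupport (V k) := fun k =>
    ((hc.mul_right).mul_right).mul_right
  have key : ∀ x, flux α l i (ζ x) (grad ζ x) (v x) (grad v x) (hessian v x)
      = ∑ k, fderiv ℝ (V k) x (EuclideanSpace.single k 1) := by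
    intro x
    have hd1 : ContDiff ℝ 2 (fderiv ℝ v) := hv.fderiv_right (by norm_num)
    have hd2 : ContDiff ℝ 1 (fderiv ℝ (fderiv ℝ v)) := hd1.fderiv_right (by norm_num)
    set D : Fin n → Matrix (Fin n) (Fin n) ℝ := fun k => Matrix.of fun i j =>
      fderiv ℝ (fderiv ℝ (fderiv ℝ v)) x (EuclideanSpace.single k 1) (EuclideanSpace.single i 1)
        (EuclideanSpace.single j 1) with hDdef
    have hDl : ∀ k i j, HasDerivAt
        (fun t : ℝ => hessian v (x + t • EuclideanSpace.single k 1) i j) (D k i j) 0 :=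
      fun k i j => hasDerivAt_hessian_line (hd2.differentiable (by simp) x) k i j
    have hD : ∀ l, (D l)ᵀ = D l := by
      intro l
      ext i j
      refine (hDl l j i).unique ?_
      have e : (fun t : ℝ => hessian v (x + t • EuclideanSpace.single l 1) j i)
          = fun t : ℝ => hessian v (x + t • EuclideanSpace.single l 1) i j := by
        funext t
        have := hessian_transpose (hv.contDiffAt.of_le (by norm_num) :
          ContDiffAt ℝ 2 v (x + t • EuclideanSpace.single l 1))
        exact congrFun (congrFun this i) j
      rw [e]
      exact hDl l i j
    have hD' : ∀ l i j, D l i j = D i l j := by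
      intro l i j
      have := (hd1.contDiffAt (x := x)).isSymmSndFDerivAt (by simp)
        (EuclideanSpace.single l 1) (EuclideanSpace.single i 1)
      exact congrArg (fun L => L (EuclideanSpace.single j 1)) this
    have hHs := hessian_transpose (hv.contDiffAt.of_le (by norm_num) : ContDiffAt ℝ 2 v x)
    rw [← flux_eq α l i (ζ x) (grad ζ x) (hpos x) (grad v x) hHs hD hD']
    refine Finset.sum_congr rfl fun k _ => ?_
    refine HasDerivAt.unique ?_ (hasDerivAt_line ((hVc k).differentiable (by simp) x) _)
    have hζl := hasDerivAt_line (hζ.differentiable (by simp) x) (EuclideanSpace.single k 1)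
    have hvl := hasDerivAt_line (hv1.differentiable (by simp) x) (EuclideanSpace.single k 1)
    have hgl := fun j => hasDerivAt_grad_line (hd1.differentiable (by simp) x) k j
    have hx0 : x + (0 : ℝ) • EuclideanSpace.single k (1 : ℝ) = x := by simp
    have hPl : HasDerivAt (fun t : ℝ => grad v (x + t • EuclideanSpace.single k 1) ⬝ᵥ
        grad v (x + t • EuclideanSpace.single k 1)) (2 * (hessian v x *ᵥ grad v x) k) 0 := by
      refine HasDerivAt.congr_deriv (HasDerivAt.fun_sum (u := Finset.univ) fun j _ =>
        (hgl j).fun_mul (hgl j)) ?_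
      rw [hx0, mulVec, dotProduct, Finset.mul_sum]
      exact Finset.sum_congr rfl fun j _ => by ring
    have hAl : ∀ a b, HasDerivAt (fun t : ℝ => A (x + t • EuclideanSpace.single k 1) a b)
        ((grad v x k • hessian v x + v x • D k - (hessian v x *ᵥ grad v x) k •
          (1 : Matrix (Fin n) (Fin n) ℝ)) a b) 0 := by
      intro a b
      simp only [hAdef, jetA, Matrix.sub_apply, Matrix.smul_apply, Matrix.add_apply, smul_eq_mul]
      refine HasDerivAt.congr_deriv ((hvl.fun_mul (hDl k a b)).fun_sub
        ((hPl.const_mul (1 / 2)).mul_const _)) ?_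
      rw [hx0, grad]
      ring
    have hTl := (hasDerivAt_sig_newton hAl i).2
    have hWl : HasDerivAt (fun t : ℝ => W k (x + t • EuclideanSpace.single k 1)) _ 0 :=
      HasDerivAt.fun_sum (u := Finset.univ) fun j _ => (hTl k j).fun_mul (hgl j)
    have hpw := hvl.rpow_const (p := α + 1) (Or.inl (by rw [hx0]; exact (hpos x).ne'))
    refine HasDerivAt.congr_deriv (((hζl.fun_mul hpw).fun_mul (hPl.fun_pow l)).fun_mul hWl) ?_
    rw [hx0, add_sub_cancel_right]
    simp only [hW, hAdef, grad]
    ring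
  simp only [key]
  rw [integral_finsetSum _ fun k _ => (integral_fderiv_eq_zero (hVc k) (hVs k) _).1]
  exact Finset.sum_eq_zero fun k _ => (integral_fderiv_eq_zero (hVc k) (hVs k) _).2

end

/-! ### Approximation: the divergence formula for `C²` functions -/

section

open Matrix

variable {n : ℕ}

/-- A positive `C²` function on `B_3` agrees on a smaller ball with a positive `C²` function on
`ℝⁿ` that equals `1` outside a compact set. -/
theorem exists_extension {u : EuclideanSpace ℝ (Fin n) → ℝ}
    (hu : ContDiffOn ℝ 2 u (Metric.ball 0 3)) (hpos : ∀ x ∈ Metric.ball 0 3, 0 < u x) {R : ℝ}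
    (hR0 : 0 < R) (hR : R < 3) :
    ∃ w : EuclideanSpace ℝ (Fin n) → ℝ, ContDiff ℝ 2 w ∧ (∀ x, 0 < w x) ∧
      HasCompactSupport (fun x => w x - 1) ∧ ∀ x ∈ Metric.ball 0 R, w x = u x := by
  let χ : ContDiffBump (0 : EuclideanSpace ℝ (Fin n)) := ⟨R, (R + 3) / 2, hR0, by linarith⟩
  have hball : Metric.closedBall (0 : EuclideanSpace ℝ (Fin n)) ((R + 3) / 2) ⊆ Metric.ball 0 3 :=
    Metric.closedBall_subset_ball (by linarith)
  refine ⟨fun x => 1 + χ x * (u x - 1), ?_, ?_, ?_, ?_⟩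
  · rw [contDiff_iff_contDiffAt]
    intro x
    by_cases hx : x ∈ Metric.ball (0 : EuclideanSpace ℝ (Fin n)) 3
    · have h1 : ContDiffAt ℝ 2 u x := hu.contDiffAt (Metric.isOpen_ball.mem_nhds hx)
      exact contDiffAt_const.add (χ.contDiffAt.mul (h1.sub contDiffAt_const))
    · have hx' : x ∈ (Metric.closedBall (0 : EuclideanSpace ℝ (Fin n)) ((R + 3) / 2))ᶜ :=
        fun h => hx (hball h)
      have he : (fun x => 1 + χ x * (u x - 1)) =ᶠ[𝓝 x] fun _ => 1 := by
        filter_upwards [Metric.isClosed_closedBall.isOpen_compl.mem_nhds hx'] with y hy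
        have : χ y = 0 := by
          refine χ.zero_of_le_dist ?_
          simp only [Set.mem_compl_iff, Metric.mem_closedBall, not_le] at hy
          exact hy.le
        simp [this]
      exact contDiffAt_const.congr_of_eventuallyEq he
  · intro x
    by_cases hx : x ∈ Metric.ball (0 : EuclideanSpace ℝ (Fin n)) 3
    · have h1 := hpos x hx
      have h2 : 0 ≤ χ x := χ.nonneg
      have h3 : χ x ≤ 1 := χ.le_one
      rcases h3.lt_or_eq with h | h
      · nlinarith [mul_nonneg h2 h1.le]
      · simp only [h]; linarith
    · have : χ x = 0 := by
        refine χ.zero_of_le_dist ?_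
        simp only [Metric.mem_ball, not_lt] at hx
        change (R + 3) / 2 ≤ _
        linarith
      simp [this]
  · have : (fun x => 1 + χ x * (u x - 1) - 1) = fun x => χ x * (u x - 1) := by
      funext x; ring
    rw [this]
    exact χ.hasCompactSupport.mul_right
  · intro x hx
    have : χ x = 1 := χ.one_of_mem_closedBall (Metric.ball_subset_closedBall hx)
    simp [this]

open Convolution in
theorem tendstoUniformly_convolution {F : Type*} [NormedAddCommGroup F] [NormedSpace ℝ F]
    [CompleteSpace F] {φ : ℕ → ContDiffBump (0 : EuclideanSpace ℝ (Fin n))}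
    (hφ : Tendsto (fun m => (φ m).rOut) atTop (𝓝 0)) {f : EuclideanSpace ℝ (Fin n) → F}
    (hf : Continuous f) (hc : HasCompactSupport f) :
    TendstoUniformly (fun m => (φ m).normed volume ⋆[ContinuousLinearMap.lsmul ℝ ℝ, volume] f) f
      atTop := by
  have hu : UniformContinuous f := hc.uniformContinuous_of_continuous hf
  rw [Metric.tendstoUniformly_iff]
  intro ε hε
  obtain ⟨δ, hδ, h⟩ := Metric.uniformContinuous_iff.1 hu (ε / 2) (by positivity)
  filter_upwards [hφ.eventually (gt_mem_nhds hδ)] with m hm x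
  rw [dist_comm]
  refine lt_of_le_of_lt (ContDiffBump.dist_normed_convolution_le
    hf.aestronglyMeasurable (ε := ε / 2) fun y hy => ?_) (by linarith)
  exact (h (lt_trans (Metric.mem_ball.1 hy) hm)).le

open Convolution in
theorem fderiv_normed_convolution {F : Type*} [NormedAddCommGroup F] [NormedSpace ℝ F]
    [CompleteSpace F] (φ : ContDiffBump (0 : EuclideanSpace ℝ (Fin n)))
    {f : EuclideanSpace ℝ (Fin n) → F} (hf : ContDiff ℝ 1 f) (hc : HasCompactSupport f) :
    fderiv ℝ (φ.normed volume ⋆[ContinuousLinearMap.lsmul ℝ ℝ, volume] f)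
      = φ.normed volume ⋆[ContinuousLinearMap.lsmul ℝ ℝ, volume] fderiv ℝ f := by
  funext x
  have h := hc.hasFDerivAt_convolution_right (ContinuousLinearMap.lsmul ℝ ℝ) (μ := volume)
    (f := φ.normed volume) φ.continuous_normed.locallyIntegrable hf x
  rw [h.fderiv]
  rfl

open Convolution in
/-- A `C²` function that is constant at infinity is a limit of smooth functions, uniformly with
its derivatives of order at most two. -/
theorem exists_smooth_approx {w : EuclideanSpace ℝ (Fin n) → ℝ} (hw : ContDiff ℝ 2 w)
    (hc : HasCompactSupport (fun x => w x - 1)) :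
    ∃ v : ℕ → EuclideanSpace ℝ (Fin n) → ℝ, (∀ m, ContDiff ℝ 3 (v m)) ∧
      TendstoUniformly v w atTop ∧
      TendstoUniformly (fun m => fderiv ℝ (v m)) (fderiv ℝ w) atTop ∧
      TendstoUniformly (fun m => fderiv ℝ (fderiv ℝ (v m))) (fderiv ℝ (fderiv ℝ w)) atTop := by
  set g : EuclideanSpace ℝ (Fin n) → ℝ := fun x => w x - 1 with hg
  have hg2 : ContDiff ℝ 2 g := hw.sub contDiff_const
  have hg1 : ContDiff ℝ 1 g := hg2.of_le (by norm_num)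
  have hdg1 : ContDiff ℝ 1 (fderiv ℝ g) := hg2.fderiv_right (by norm_num)
  have hdw : fderiv ℝ g = fderiv ℝ w := by
    funext x; rw [hg, fderiv_sub_const]
  let φ : ℕ → ContDiffBump (0 : EuclideanSpace ℝ (Fin n)) := fun m =>
    ⟨1 / ((m : ℝ) + 1) / 2, 1 / ((m : ℝ) + 1), by positivity, half_lt_self (by positivity)⟩
  have hφ : Tendsto (fun m => (φ m).rOut) atTop (𝓝 0) :=
    tendsto_one_div_add_atTop_nhds_zero_nat
  set gm : ℕ → EuclideanSpace ℝ (Fin n) → ℝ := fun m =>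
    (φ m).normed volume ⋆[ContinuousLinearMap.lsmul ℝ ℝ, volume] g with hgm
  have hd1 : ∀ m, fderiv ℝ (fun x => 1 + gm m x)
      = (φ m).normed volume ⋆[ContinuousLinearMap.lsmul ℝ ℝ, volume] fderiv ℝ w := by
    intro m
    rw [← hdw, ← fderiv_normed_convolution (φ m) hg1 hc]
    funext x; simp [hgm]
  refine ⟨fun m x => 1 + gm m x, fun m => ?_, ?_, ?_, ?_⟩
  · refine contDiff_const.add ?_
    exact ((φ m).hasCompactSupport_normed).contDiff_convolution_left _ (φ m).contDiff_normed
      (hg1.continuous.locallyIntegrable)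
  · have h := tendstoUniformly_convolution hφ hg1.continuous hc
    rw [Metric.tendstoUniformly_iff] at h ⊢
    intro ε hε
    filter_upwards [h ε hε] with m hm x
    have := hm x
    rw [Real.dist_eq] at this ⊢
    simp only [hg] at this
    convert this using 2
    simp only [hgm, hg]
    ring
  · simp only [hd1]
    rw [← hdw]
    exact tendstoUniformly_convolution hφ hdg1.continuous (hc.fderiv ℝ)
  · simp only [hd1]
    rw [← hdw]
    simp only [fderiv_normed_convolution _ hdg1 (hc.fderiv ℝ)]
    exact tendstoUniformly_convolution hφ (hdg1.continuous_fderiv (by simp))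
      ((hc.fderiv ℝ).fderiv ℝ)

theorem continuous_jetA : Continuous (fun y : ℝ × (Fin n → ℝ) × Matrix (Fin n) (Fin n) ℝ =>
    jetA y.1 y.2.1 y.2.2) := by
  unfold jetA
  have h1 : Continuous (fun y : ℝ × (Fin n → ℝ) × Matrix (Fin n) (Fin n) ℝ => y.2.1 ⬝ᵥ y.2.1) :=
    Continuous.dotProduct (by fun_prop) (by fun_prop)
  have h2 : Continuous (fun y : ℝ × (Fin n → ℝ) × Matrix (Fin n) (Fin n) ℝ => y.1 • y.2.2) := by
    fun_prop
  exact h2.sub ((continuous_const.mul h1).smul continuous_const)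

theorem continuousOn_flux (α : ℝ) (l i : ℕ) :
    ContinuousOn (fun y : (ℝ × (Fin n → ℝ)) × ℝ × (Fin n → ℝ) × Matrix (Fin n) (Fin n) ℝ =>
      flux α l i y.1.1 y.1.2 y.2.1 y.2.2.1 y.2.2.2) {y | 0 < y.2.1} := by
  have hA : Continuous (fun y : (ℝ × (Fin n → ℝ)) × ℝ × (Fin n → ℝ) × Matrix (Fin n) (Fin n) ℝ =>
      jetA y.2.1 y.2.2.1 y.2.2.2) := continuous_jetA.comp continuous_snd
  have hp : Continuous (fun y : (ℝ × (Fin n → ℝ)) × ℝ × (Fin n → ℝ) × Matrix (Fin n) (Fin n) ℝ =>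
      y.2.2.1) := by fun_prop
  have hq : Continuous (fun y : (ℝ × (Fin n → ℝ)) × ℝ × (Fin n → ℝ) × Matrix (Fin n) (Fin n) ℝ =>
      y.1.2) := by fun_prop
  have hz : Continuous (fun y : (ℝ × (Fin n → ℝ)) × ℝ × (Fin n → ℝ) × Matrix (Fin n) (Fin n) ℝ =>
      y.1.1) := by fun_prop
  have hs : Continuous (fun y : (ℝ × (Fin n → ℝ)) × ℝ × (Fin n → ℝ) × Matrix (Fin n) (Fin n) ℝ =>
      y.2.1) := by fun_prop
  have hP := hp.dotProduct hp
  have hT := fun m => ((continuous_newton_sig (n := n) m).1.comp hA).matrix_mulVec hp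
  have hS := fun m => (continuous_newton_sig (n := n) m).2.comp hA
  have hr : ∀ β : ℝ, ContinuousOn (fun y : (ℝ × (Fin n → ℝ)) × ℝ × (Fin n → ℝ) ×
      Matrix (Fin n) (Fin n) ℝ => y.2.1 ^ β) {y | 0 < y.2.1} :=
    fun β => hs.continuousOn.rpow_const fun y hy => Or.inl (ne_of_gt hy)
  refine ContinuousOn.add ((((hq.dotProduct (hT i)).continuousOn).mul (hr _)).mul
    (hP.pow l).continuousOn) ((hz.continuousOn.mul (hr α)).mul (Continuous.continuousOn ?_))
  exact ((((continuous_const.mul (hP.pow l)).mul (hS (i + 1))).sub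
    ((continuous_const.mul (hP.pow (l + 1))).mul (hS i))).add
    ((continuous_const.mul (hP.pow l)).mul (hp.dotProduct (hT i)))).sub
    ((continuous_const.mul (hP.pow (l - 1))).mul (hp.dotProduct (hT (i + 1))))

theorem flux_zero (α : ℝ) (l i : ℕ) (s : ℝ) (p : Fin n → ℝ) (H : Matrix (Fin n) (Fin n) ℝ) :
    flux α l i 0 0 s p H = 0 := by simp [flux]

theorem continuous_grad {v : EuclideanSpace ℝ (Fin n) → ℝ} (hv : ContDiff ℝ 1 v) :
    Continuous (grad v) :=
  continuous_pi fun i => (hv.continuous_fderiv (by simp)).clm_apply continuous_const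

theorem continuous_hessian {v : EuclideanSpace ℝ (Fin n) → ℝ} (hv : ContDiff ℝ 2 v) :
    Continuous (hessian v) :=
  continuous_pi fun i => continuous_pi fun j =>
    (contDiff_hessian (r := 0) (hv.of_le (by norm_num)) i j).continuous

theorem continuous_flux (α : ℝ) (l i : ℕ) {w ζ : EuclideanSpace ℝ (Fin n) → ℝ}
    (hw : ContDiff ℝ 2 w) (hpos : ∀ x, 0 < w x) (hζ : ContDiff ℝ 1 ζ) :
    Continuous (fun x => flux α l i (ζ x) (grad ζ x) (w x) (grad w x) (hessian w x)) := by
  refine (continuousOn_flux α l i).comp_continuous (f := fun x => ((ζ x, grad ζ x),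
    (w x, (grad w x, hessian w x)))) ?_ hpos
  exact (hζ.continuous.prodMk (continuous_grad hζ)).prodMk (hw.continuous.prodMk
    ((continuous_grad (hw.of_le (by norm_num))).prodMk (continuous_hessian hw)))

theorem zero_of_notMem_tsupport {ζ : EuclideanSpace ℝ (Fin n) → ℝ} {x : EuclideanSpace ℝ (Fin n)}
    (hx : x ∉ tsupport ζ) : ζ x = 0 ∧ grad ζ x = 0 := by
  refine ⟨image_eq_zero_of_notMem_tsupport hx, ?_⟩
  funext i
  have : fderiv ℝ ζ x = 0 := by
    by_contra h
    exact hx (support_fderiv_subset ℝ h)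
  simp [grad, this]

theorem abs_grad_le (v : EuclideanSpace ℝ (Fin n) → ℝ) (x : EuclideanSpace ℝ (Fin n)) (i : Fin n) :
    |grad v x i| ≤ ‖fderiv ℝ v x‖ := by
  have := (fderiv ℝ v x).le_opNorm (EuclideanSpace.single i 1)
  simpa [grad] using this

theorem abs_hessian_le (v : EuclideanSpace ℝ (Fin n) → ℝ) (x : EuclideanSpace ℝ (Fin n))
    (i j : Fin n) : |hessian v x i j| ≤ ‖fderiv ℝ (fderiv ℝ v) x‖ := by
  have := (fderiv ℝ (fderiv ℝ v) x).le_opNorm₂ (EuclideanSpace.single i 1)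
    (EuclideanSpace.single j 1)
  simpa [hessian] using this

/-- The divergence formula for `C²` functions, by approximation. -/
theorem integral_flux_contDiff_two (α : ℝ) (l i : ℕ) {w ζ : EuclideanSpace ℝ (Fin n) → ℝ}
    (hw : ContDiff ℝ 2 w) (hpos : ∀ x, 0 < w x) (hwc : HasCompactSupport (fun x => w x - 1))
    (hζ : ContDiff ℝ 1 ζ) (hc : HasCompactSupport ζ) :
    Integrable (fun x => flux α l i (ζ x) (grad ζ x) (w x) (grad w x) (hessian w x)) ∧
    ∫ x, flux α l i (ζ x) (grad ζ x) (w x) (grad w x) (hessian w x) = 0 := by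
  have hint : Integrable (fun x => flux α l i (ζ x) (grad ζ x) (w x) (grad w x) (hessian w x)) := by
    refine (continuous_flux α l i hw hpos hζ).integrable_of_hasCompactSupport
      (HasCompactSupport.intro hc fun x hx => ?_)
    rw [(zero_of_notMem_tsupport hx).1, (zero_of_notMem_tsupport hx).2, flux_zero]
  refine ⟨hint, ?_⟩
  obtain ⟨v, hv, h0, h1, h2⟩ := exists_smooth_approx hw hwc
  -- a positive lower bound for `w`
  obtain ⟨c, hc0, hcw⟩ : ∃ c, 0 < c ∧ ∀ x, c ≤ w x := by
    obtain ⟨c, hc0, hcw⟩ := hwc.isCompact.exists_forall_le' hw.continuous.continuousOn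
      (a := 0) (fun x _ => hpos x)
    refine ⟨min c 1, lt_min hc0 one_pos, fun x => ?_⟩
    by_cases hx : x ∈ tsupport (fun x => w x - 1)
    · exact (min_le_left _ _).trans (hcw x hx)
    · have : w x - 1 = 0 := image_eq_zero_of_notMem_tsupport (f := fun x => w x - 1) hx
      exact (min_le_right _ _).trans (by linarith)
  -- upper bounds on the support of `ζ`
  have hbd : ∀ {F : Type} [NormedAddCommGroup F] (f : EuclideanSpace ℝ (Fin n) → F),
      Continuous f → ∃ M, ∀ x ∈ tsupport ζ, ‖f x‖ ≤ M := fun f hf =>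
    hc.isCompact.exists_bound_of_continuousOn hf.continuousOn
  obtain ⟨M0, hM0⟩ := hbd w hw.continuous
  obtain ⟨M1, hM1⟩ := hbd (fderiv ℝ w) (hw.continuous_fderiv (by simp))
  obtain ⟨M2, hM2⟩ := hbd (fderiv ℝ (fderiv ℝ w))
    ((hw.fderiv_right (m := 1) (by norm_num)).continuous_fderiv (by simp))
  obtain ⟨N0, hN0⟩ := hbd ζ hζ.continuous
  obtain ⟨N1, hN1⟩ := hbd (fderiv ℝ ζ) (hζ.continuous_fderiv (by simp))
  set K : Set ((ℝ × (Fin n → ℝ)) × ℝ × (Fin n → ℝ) × Matrix (Fin n) (Fin n) ℝ) :=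
    (Set.Icc (-N0) N0 ×ˢ Set.univ.pi fun _ => Set.Icc (-N1) N1) ×ˢ
      Set.Icc (c / 2) (M0 + 1) ×ˢ (Set.univ.pi fun _ => Set.Icc (-(M1 + 1)) (M1 + 1)) ×ˢ
      (Set.univ.pi fun _ => Set.univ.pi fun _ => Set.Icc (-(M2 + 1)) (M2 + 1)) with hK
  have hKc : IsCompact K :=
    (isCompact_Icc.prod (isCompact_univ_pi fun _ => isCompact_Icc)).prod
      (isCompact_Icc.prod ((isCompact_univ_pi fun _ => isCompact_Icc).prod
        (isCompact_univ_pi fun _ => isCompact_univ_pi fun _ => isCompact_Icc)))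
  obtain ⟨B, hB⟩ := hKc.exists_bound_of_continuousOn ((continuousOn_flux (n := n) α l i).mono (by
    rintro ⟨_, s, _⟩ hy
    have : c / 2 ≤ s := hy.2.1.1
    change 0 < s
    linarith))
  have hlt : ∀ {F : Type} [NormedAddCommGroup F] {a b : F}, dist a b < 1 → ‖b - a‖ < 1 := by
    intro F _ a b h
    rwa [← dist_eq_norm, dist_comm]
  have hev : ∀ᶠ m in atTop, ∀ x, c / 2 < v m x ∧ |v m x - w x| < 1 ∧
      ‖fderiv ℝ (v m) x - fderiv ℝ w x‖ < 1 ∧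
      ‖fderiv ℝ (fderiv ℝ (v m)) x - fderiv ℝ (fderiv ℝ w) x‖ < 1 := by
    filter_upwards [Metric.tendstoUniformly_iff.1 h0 (c / 2) (by positivity),
      Metric.tendstoUniformly_iff.1 h0 1 one_pos, Metric.tendstoUniformly_iff.1 h1 1 one_pos,
      (Metric.tendstoUniformly_iff (α := EuclideanSpace ℝ (Fin n) →L[ℝ]
        EuclideanSpace ℝ (Fin n) →L[ℝ] ℝ)).1 h2 1 one_pos]
      with m a1 a2 a3 a4 x
    refine ⟨?_, ?_, ?_, ?_⟩
    · have := a1 x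
      rw [Real.dist_eq, abs_lt] at this
      linarith [hcw x]
    · rw [abs_sub_comm]; exact a2 x
    · exact hlt (a3 x)
    · exact hlt (F := EuclideanSpace ℝ (Fin n) →L[ℝ] EuclideanSpace ℝ (Fin n) →L[ℝ] ℝ) (a4 x)
  have hlim : Tendsto (fun m => ∫ x, flux α l i (ζ x) (grad ζ x) (v m x) (grad (v m) x)
      (hessian (v m) x)) atTop
      (𝓝 (∫ x, flux α l i (ζ x) (grad ζ x) (w x) (grad w x) (hessian w x))) := by
    refine tendsto_integral_filter_of_dominated_convergence
      (fun x => (tsupport ζ).indicator (fun _ => B) x) ?_ ?_ ?_ ?_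
    · filter_upwards [hev] with m hm
      exact (continuous_flux α l i ((hv m).of_le (by norm_num))
        (fun x => lt_trans (by positivity) (hm x).1) hζ).aestronglyMeasurable
    · filter_upwards [hev] with m hm
      refine Eventually.of_forall fun x => ?_
      by_cases hx : x ∈ tsupport ζ
      · rw [Set.indicator_of_mem hx]
        obtain ⟨b0, b1, b2, b3⟩ := hm x
        refine hB ((ζ x, grad ζ x), (v m x, (grad (v m) x, hessian (v m) x))) ?_
        have c1 : ‖fderiv ℝ (v m) x‖ ≤ M1 + 1 := by
          have := norm_le_norm_add_norm_sub' (fderiv ℝ (v m) x) (fderiv ℝ w x)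
          linarith [hM1 x hx]
        have c2 : ‖fderiv ℝ (fderiv ℝ (v m)) x‖ ≤ M2 + 1 := by
          have := norm_le_norm_add_norm_sub' (fderiv ℝ (fderiv ℝ (v m)) x)
            (fderiv ℝ (fderiv ℝ w) x)
          linarith [hM2 x hx]
        refine ⟨⟨abs_le.1 (hN0 x hx), fun j _ => abs_le.1 ((abs_grad_le ζ x j).trans (hN1 x hx))⟩,
          ⟨b0.le, ?_⟩, fun j _ => abs_le.1 ((abs_grad_le _ x j).trans c1),
          fun a _ b _ => abs_le.1 ((abs_hessian_le _ x a b).trans c2)⟩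
        have := (le_abs_self _).trans (hM0 x hx)
        change v m x ≤ M0 + 1
        linarith [(abs_lt.1 b1).2]
      · rw [Set.indicator_of_notMem hx, (zero_of_notMem_tsupport hx).1,
          (zero_of_notMem_tsupport hx).2, flux_zero, norm_zero]
    · exact (integrable_indicator_iff (isClosed_tsupport ζ).measurableSet).2
        (integrableOn_const hc.isCompact.measure_lt_top.ne)
    · refine Eventually.of_forall fun x => ?_
      have hcont := (continuousOn_flux (n := n) α l i).continuousAt (x := ((ζ x, grad ζ x),
        (w x, (grad w x, hessian w x)))) ((isOpen_lt continuous_const (by fun_prop)).mem_nhds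
          (hpos x))
      refine hcont.tendsto.comp (f := fun m => ((ζ x, grad ζ x), (v m x, (grad (v m) x,
        hessian (v m) x)))) ?_
      refine tendsto_const_nhds.prodMk_nhds ((h0.tendsto_at x).prodMk_nhds
        (Tendsto.prodMk_nhds ?_ ?_))
      · exact tendsto_pi_nhds.2 fun j =>
          ((ContinuousLinearMap.apply ℝ ℝ (EuclideanSpace.single j (1 : ℝ))).continuous.tendsto
            _).comp (h1.tendsto_at x)
      · exact tendsto_pi_nhds.2 fun a => tendsto_pi_nhds.2 fun b =>
          ((hessianEntry a b).continuous.tendsto _).comp (h2.tendsto_at x)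
  refine tendsto_nhds_unique hlim (tendsto_const_nhds.congr' ?_)
  filter_upwards [hev] with m hm
  exact (integral_flux_smooth α l i (hv m) (fun x => lt_trans (by positivity) (hm x).1) hζ hc).symm

theorem grad_congr {u w : EuclideanSpace ℝ (Fin n) → ℝ} {x : EuclideanSpace ℝ (Fin n)}
    (h : u =ᶠ[𝓝 x] w) : grad u x = grad w x := by
  funext i; rw [grad, grad, h.fderiv_eq]

theorem hessian_congr {u w : EuclideanSpace ℝ (Fin n) → ℝ} {x : EuclideanSpace ℝ (Fin n)}
    (h : u =ᶠ[𝓝 x] w) : hessian u x = hessian w x := by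
  ext i j; simp only [hessian, Matrix.of_apply, h.fderiv.fderiv_eq]

/-- The divergence formula for positive `C²` functions on `B_3`, with a cutoff supported inside. -/
theorem integral_flux_eq_zero (α : ℝ) (l i : ℕ) {u ζ : EuclideanSpace ℝ (Fin n) → ℝ}
    (hu : ContDiffOn ℝ 2 u (Metric.ball 0 3)) (hpos : ∀ x ∈ Metric.ball 0 3, 0 < u x) {R : ℝ}
    (hR0 : 0 < R) (hR : R < 3) (hζ : ContDiff ℝ 1 ζ) (hc : HasCompactSupport ζ)
    (hs : tsupport ζ ⊆ Metric.ball 0 R) :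
    Integrable (fun x => flux α l i (ζ x) (grad ζ x) (u x) (grad u x) (hessian u x)) ∧
    ∫ x, flux α l i (ζ x) (grad ζ x) (u x) (grad u x) (hessian u x) = 0 := by
  obtain ⟨w, hw, hwpos, hwc, hwu⟩ := exists_extension hu hpos hR0 hR
  have e : (fun x => flux α l i (ζ x) (grad ζ x) (u x) (grad u x) (hessian u x))
      = fun x => flux α l i (ζ x) (grad ζ x) (w x) (grad w x) (hessian w x) := by
    funext x
    by_cases hx : x ∈ tsupport ζ
    · have he : u =ᶠ[𝓝 x] w := by
        filter_upwards [Metric.isOpen_ball.mem_nhds (hs hx)] with y hy using (hwu y hy).symm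
      rw [he.eq_of_nhds, grad_congr he, hessian_congr he]
    · rw [(zero_of_notMem_tsupport hx).1, (zero_of_notMem_tsupport hx).2, flux_zero, flux_zero]
  rw [e]
  exact integral_flux_contDiff_two α l i hw hwpos hwc hζ hc

end

/-! ### The mean value inequality -/

section

open Matrix

variable {n : ℕ}

/-- The radial weight `(1 - |y|²)₊` of the mean value inequality. -/
noncomputable def weight (y : EuclideanSpace ℝ (Fin n)) : ℝ := max 0 (1 - ‖y‖ ^ 2)

theorem weight_nonneg (y : EuclideanSpace ℝ (Fin n)) : 0 ≤ weight y := le_max_left _ _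

theorem weight_le_one (y : EuclideanSpace ℝ (Fin n)) : weight y ≤ 1 :=
  max_le zero_le_one (by nlinarith [sq_nonneg ‖y‖])

theorem weight_eq_zero {y : EuclideanSpace ℝ (Fin n)} (hy : y ∉ Metric.ball 0 1) :
    weight y = 0 := by
  simp only [Metric.mem_ball, dist_zero_right, not_lt] at hy
  exact max_eq_left (by nlinarith)

theorem continuous_weight : Continuous (weight (n := n)) := by
  unfold weight; fun_prop

theorem hasCompactSupport_weight : HasCompactSupport (weight (n := n)) :=
  HasCompactSupport.intro (isCompact_closedBall 0 1) fun _ hy =>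
    weight_eq_zero fun h => hy (Metric.ball_subset_closedBall h)

theorem integral_weight_pos : 0 < ∫ y, weight (n := n) y := by
  refine continuous_weight.integral_pos_of_hasCompactSupport_nonneg_nonzero
    hasCompactSupport_weight weight_nonneg (x := 0) ?_
  simp [weight]

theorem integrable_weight_mul {f : EuclideanSpace ℝ (Fin n) → ℝ} (hf : Continuous f) :
    Integrable (fun y => weight y * f y) :=
  (continuous_weight.mul hf).integrable_of_hasCompactSupport hasCompactSupport_weight.mul_right

theorem fderiv_weight_sq (y : EuclideanSpace ℝ (Fin n)) :
    DifferentiableAt ℝ (fun y => weight y ^ 2) y ∧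
    ∀ i, fderiv ℝ (fun y : EuclideanSpace ℝ (Fin n) => weight y ^ 2) y (EuclideanSpace.single i 1)
      = -(4 * (weight y * y i)) := by
  have h1 : ∀ s : ℝ, HasDerivAt (fun s : ℝ => (max 0 s) ^ 2) (2 * max 0 s) s := by
    intro s
    rcases lt_trichotomy s 0 with h | h | h
    · rw [max_eq_left h.le, mul_zero]
      refine (hasDerivAt_const s (0 : ℝ)).congr_of_eventuallyEq ?_
      filter_upwards [Iio_mem_nhds h] with t ht
      rw [max_eq_left (le_of_lt ht)]; simp
    · -- at the kink the function is squeezed between `0` and `s²`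
      subst h
      rw [max_self, mul_zero, hasDerivAt_iff_isLittleO]
      have hb : (fun x' : ℝ => max 0 x' ^ 2 - max 0 (0 : ℝ) ^ 2 - (x' - 0) • (0 : ℝ))
          =O[𝓝 0] fun x' : ℝ => x' ^ 2 := by
        refine Asymptotics.IsBigO.of_bound 1 (Eventually.of_forall fun t => ?_)
        simp only [max_self, smul_zero, sub_zero, ne_eq, OfNat.ofNat_ne_zero, not_false_eq_true,
          zero_pow, norm_pow, Real.norm_eq_abs, one_mul]
        refine pow_le_pow_left₀ (abs_nonneg _) ?_ 2
        rcases le_total 0 t with h | h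
        · rw [max_eq_right h]
        · rw [max_eq_left h]; simp
      refine hb.trans_isLittleO ?_
      simpa using Asymptotics.isLittleO_pow_id (𝕜 := ℝ) (n := 2) (by norm_num)
    · rw [max_eq_right h.le]
      have := (hasDerivAt_id s).fun_pow 2
      refine HasDerivAt.congr_of_eventuallyEq (f := fun s : ℝ => s ^ 2) ?_ ?_
      · simpa using this
      · filter_upwards [Ioi_mem_nhds h] with t ht
        rw [max_eq_right (le_of_lt ht)]
  have h2 : HasFDerivAt (fun y : EuclideanSpace ℝ (Fin n) => 1 - ‖y‖ ^ 2)
      (-(2 • innerSL ℝ y)) y := (hasStrictFDerivAt_norm_sq y).hasFDerivAt.const_sub 1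
  have h3 := (h1 (1 - ‖y‖ ^ 2)).comp_hasFDerivAt y h2
  have h4 : HasFDerivAt (fun y : EuclideanSpace ℝ (Fin n) => weight y ^ 2) _ y := h3
  refine ⟨h4.differentiableAt, fun i => ?_⟩
  rw [h4.fderiv]
  simp only [_root_.smul_apply, _root_.neg_apply, innerSL_apply_apply,
    EuclideanSpace.inner_single_right, weight]
  simp
  ring

theorem fderiv_apply_eq_sum (w : EuclideanSpace ℝ (Fin n) → ℝ) (x y : EuclideanSpace ℝ (Fin n)) :
    fderiv ℝ w x y = ∑ i, y i * grad w x i := by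
  have : y = ∑ i, y i • EuclideanSpace.single i (1 : ℝ) := by
    ext j; simp [Finset.sum_apply, Pi.single_apply]
  conv_lhs => rw [this]
  simp [grad, map_sum]

/-- Differentiation of the weighted mean of `w` over `B_t(x)` with respect to the radius. -/
theorem hasDerivAt_integral_weight {w : EuclideanSpace ℝ (Fin n) → ℝ} (hw : ContDiff ℝ 2 w)
    (x : EuclideanSpace ℝ (Fin n)) (t : ℝ) :
    HasDerivAt (fun t : ℝ => ∫ y, weight y * w (x + t • y))
      (∫ y, weight y * fderiv ℝ w (x + t • y) y) t := by
  have hdc : Continuous (fderiv ℝ w) := hw.continuous_fderiv (by simp)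
  obtain ⟨M, hM⟩ := (isCompact_closedBall x (|t| + 1)).exists_bound_of_continuousOn
    hdc.continuousOn
  have hM0 : 0 ≤ M := (norm_nonneg _).trans (hM x (by simp; positivity))
  refine (hasDerivAt_integral_of_dominated_loc_of_deriv_le
    (s := Metric.ball t 1) (bound := (Metric.closedBall 0 1).indicator fun _ => M)
    (F' := fun t y => weight y * fderiv ℝ w (x + t • y) y) (Metric.ball_mem_nhds t one_pos)
    ?_ ?_ ?_ ?_ ?_ ?_).2
  · exact Eventually.of_forall fun s =>
      (integrable_weight_mul (hw.continuous.comp (by fun_prop))).aestronglyMeasurable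
  · exact integrable_weight_mul (hw.continuous.comp (by fun_prop))
  · exact (integrable_weight_mul ((hdc.comp (by fun_prop)).clm_apply
      continuous_id)).aestronglyMeasurable
  · refine Eventually.of_forall fun y s hs => ?_
    by_cases hy : y ∈ Metric.closedBall (0 : EuclideanSpace ℝ (Fin n)) 1
    · rw [Set.indicator_of_mem hy, norm_mul]
      have hy1 : ‖y‖ ≤ 1 := by simpa using hy
      have hs1 : |s| ≤ |t| + 1 := by
        rw [Metric.mem_ball, Real.dist_eq] at hs
        have := abs_sub_abs_le_abs_sub s t
        linarith
      have hmem : x + s • y ∈ Metric.closedBall x (|t| + 1) := by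
        rw [Metric.mem_closedBall, dist_eq_norm, add_sub_cancel_left, norm_smul, Real.norm_eq_abs]
        nlinarith [abs_nonneg s, norm_nonneg y]
      have h1 : ‖fderiv ℝ w (x + s • y) y‖ ≤ M :=
        ((fderiv ℝ w (x + s • y)).le_opNorm y).trans (by nlinarith [hM _ hmem, norm_nonneg y])
      have h2 : ‖weight y‖ ≤ 1 := by
        rw [Real.norm_eq_abs, abs_of_nonneg (weight_nonneg y)]; exact weight_le_one y
      nlinarith [norm_nonneg (weight y), norm_nonneg (fderiv ℝ w (x + s • y) y)]
    · rw [Set.indicator_of_notMem hy,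
        weight_eq_zero fun h => hy (Metric.ball_subset_closedBall h)]
      simp
  · exact (integrable_indicator_iff Metric.isClosed_closedBall.measurableSet).2
      (integrableOn_const (isCompact_closedBall _ _).measure_lt_top.ne)
  · refine Eventually.of_forall fun y s _ => HasDerivAt.const_mul _ ?_
    have h1 : HasDerivAt (fun s : ℝ => x + s • y) y s := by
      simpa using ((hasDerivAt_id s).smul_const y).const_add x
    exact ((hw.differentiable (by simp) (x + s • y)).hasFDerivAt).comp_hasDerivAt s h1

/-- The weighted means of a subharmonic function increase with the radius. -/
theorem integral_weight_fderiv_nonneg {w : EuclideanSpace ℝ (Fin n) → ℝ} (hw : ContDiff ℝ 2 w)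
    (x : EuclideanSpace ℝ (Fin n)) {t r : ℝ} (ht : 0 ≤ t) (htr : t ≤ r)
    (hΔ : ∀ y ∈ Metric.ball x r, 0 ≤ (hessian w y).trace) :
    0 ≤ ∫ y, weight y * fderiv ℝ w (x + t • y) y := by
  have hw1 : ContDiff ℝ 1 (fderiv ℝ w) := hw.fderiv_right (by norm_num)
  have haff : ContDiff ℝ 1 (fun y : EuclideanSpace ℝ (Fin n) => x + t • y) := by fun_prop
  have hg : ∀ i, ContDiff ℝ 1 (fun y => grad w (x + t • y) i) := fun i =>
    (contDiff_grad (r := 1) (hw.of_le (by norm_num)) i).comp haff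
  have hgd : ∀ i y, fderiv ℝ (fun y => grad w (x + t • y) i) y (EuclideanSpace.single i 1)
      = t * hessian w (x + t • y) i i := by
    intro i y
    have h1 : HasFDerivAt (fun y : EuclideanSpace ℝ (Fin n) => x + t • y)
        (t • ContinuousLinearMap.id ℝ _) y := ((hasFDerivAt_id y).const_smul t).const_add x
    have h2 : HasFDerivAt (fderiv ℝ w) (fderiv ℝ (fderiv ℝ w) (x + t • y)) (x + t • y) :=
      (hw1.differentiable (by simp) _).hasFDerivAt
    have h3 := ((ContinuousLinearMap.apply ℝ ℝ
      (EuclideanSpace.single i (1 : ℝ))).hasFDerivAt.comp _ h2).comp y h1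
    have h4 : HasFDerivAt (fun y => grad w (x + t • y) i) _ y := h3
    rw [h4.fderiv]
    simp [hessian]
  have hwc : Continuous (fun y : EuclideanSpace ℝ (Fin n) => weight y ^ 2) :=
    continuous_weight.pow 2
  have hcs : HasCompactSupport (fun y : EuclideanSpace ℝ (Fin n) => weight y ^ 2) := by
    simp only [sq]
    exact hasCompactSupport_weight.mul_right
  have hyi : ∀ i, Continuous (fun y : EuclideanSpace ℝ (Fin n) => y i) := fun i => by fun_prop
  have hint1 : ∀ i, Integrable (fun y => weight y * (y i * grad w (x + t • y) i)) := fun i =>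
    integrable_weight_mul ((hyi i).mul (hg i).continuous)
  have hhc : ∀ i, Continuous (fun y => hessian w (x + t • y) i i) := fun i =>
    (contDiff_hessian (r := 0) (hw.of_le (by norm_num)) i i).continuous.comp haff.continuous
  have hint2 : ∀ i, Integrable (fun y => weight y ^ 2 * (t * hessian w (x + t • y) i i)) :=
    fun i => (hwc.mul (continuous_const.mul (hhc i))).integrable_of_hasCompactSupport
      hcs.mul_right
  -- `-4 (1 - |y|²)₊ y` is the gradient of `(1 - |y|²)₊²`
  have hibp : ∀ i, ∫ y, weight y ^ 2 * (t * hessian w (x + t • y) i i)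
      = 4 * ∫ y, weight y * (y i * grad w (x + t • y) i) := by
    intro i
    have h := integral_mul_fderiv_eq_neg_fderiv_mul_of_integrable (μ := volume)
      (f := fun y : EuclideanSpace ℝ (Fin n) => weight y ^ 2)
      (g := fun y => grad w (x + t • y) i) (v := EuclideanSpace.single i 1) ?_ ?_ ?_
      (fun y _ => (fderiv_weight_sq y).1) (fun y _ => (hg i).differentiable (by simp) y)
    · simp only [hgd, (fderiv_weight_sq _).2] at h
      rw [h, ← integral_neg, ← integral_const_mul]
      congr 1
      funext y
      ring
    · simp only [(fderiv_weight_sq _).2]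
      refine ((hint1 i).const_mul (-4)).congr (Eventually.of_forall fun y => ?_)
      simp only
      ring
    · simp only [hgd]; exact hint2 i
    · exact (hwc.mul (hg i).continuous).integrable_of_hasCompactSupport hcs.mul_right
  have hsum : ∫ y, weight y * fderiv ℝ w (x + t • y) y
      = ∑ i, ∫ y, weight y * (y i * grad w (x + t • y) i) := by
    rw [← integral_finsetSum _ fun i _ => hint1 i]
    congr 1
    funext y
    rw [fderiv_apply_eq_sum, Finset.mul_sum]
  have hpos : 0 ≤ ∑ i, ∫ y, weight y ^ 2 * (t * hessian w (x + t • y) i i) := by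
    rw [← integral_finsetSum _ fun i _ => hint2 i]
    refine integral_nonneg fun y => ?_
    by_cases hy : y ∈ Metric.ball (0 : EuclideanSpace ℝ (Fin n)) 1
    · have hm : x + t • y ∈ Metric.closedBall x t := by
        rw [Metric.mem_closedBall, dist_eq_norm, add_sub_cancel_left, norm_smul, Real.norm_eq_abs,
          abs_of_nonneg ht]
        have : ‖y‖ < 1 := by simpa using hy
        nlinarith
      have h1 : 0 ≤ t * (hessian w (x + t • y)).trace := by
        rcases ht.eq_or_lt with h | h
        · simp [← h]
        · refine mul_nonneg ht (hΔ _ ?_)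
          rw [Metric.mem_ball, dist_eq_norm, add_sub_cancel_left, norm_smul, Real.norm_eq_abs,
            abs_of_nonneg ht]
          have : ‖y‖ < 1 := by simpa using hy
          nlinarith
      have h2 : ∑ i, weight y ^ 2 * (t * hessian w (x + t • y) i i)
          = weight y ^ 2 * (t * (hessian w (x + t • y)).trace) := by
        simp only [Matrix.trace, Matrix.diag_apply, Finset.mul_sum]
      simp only [h2]
      positivity
    · simp [weight_eq_zero hy]
  simp only [hibp, ← Finset.mul_sum] at hpos
  rw [hsum]
  linarith

/-- The mean value inequality for subharmonic functions, with a radial weight. -/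
theorem mean_value_weight {u : EuclideanSpace ℝ (Fin n) → ℝ}
    (hu : ContDiffOn ℝ 2 u (Metric.ball 0 3)) (hpos : ∀ x ∈ Metric.ball 0 3, 0 < u x)
    (hΔ : ∀ y ∈ Metric.ball 0 3, 0 ≤ (hessian u y).trace) {x : EuclideanSpace ℝ (Fin n)} {r : ℝ}
    (hr : 0 < r) (hxr : ‖x‖ + r < 3) :
    (∫ y, weight (n := n) y) * u x ≤ ∫ y, weight y * u (x + r • y) := by
  have hx0 := norm_nonneg x
  obtain ⟨w, hw, -, -, hwu⟩ := exists_extension hu hpos (R := (‖x‖ + r + 3) / 2) (by linarith)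
    (by linarith)
  have hsub : Metric.ball x r ⊆ Metric.ball 0 ((‖x‖ + r + 3) / 2) := by
    refine Metric.ball_subset_ball' ?_
    rw [dist_zero_right]; linarith
  have hΔw : ∀ y ∈ Metric.ball x r, 0 ≤ (hessian w y).trace := by
    intro y hy
    have he : w =ᶠ[𝓝 y] u := by
      filter_upwards [Metric.isOpen_ball.mem_nhds (hsub hy)] with z hz using hwu z hz
    rw [hessian_congr he]
    exact hΔ y (Metric.ball_subset_ball (by linarith) (hsub hy))
  have hmono : MonotoneOn (fun t : ℝ => ∫ y, weight y * w (x + t • y)) (Set.Icc 0 r) := by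
    refine monotoneOn_of_deriv_nonneg (convex_Icc 0 r)
      (fun t _ => (hasDerivAt_integral_weight hw x t).continuousAt.continuousWithinAt)
      (fun t _ => (hasDerivAt_integral_weight hw x t).differentiableAt.differentiableWithinAt) ?_
    intro t ht
    rw [interior_Icc] at ht
    rw [(hasDerivAt_integral_weight hw x t).deriv]
    exact integral_weight_fderiv_nonneg hw x ht.1.le ht.2.le hΔw
  have h := hmono (Set.left_mem_Icc.2 hr.le) (Set.right_mem_Icc.2 hr.le) hr.le
  simp only [zero_smul, add_zero] at h
  rw [integral_mul_const, hwu x (hsub (Metric.mem_ball_self hr))] at h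
  refine h.trans (le_of_eq ?_)
  congr 1
  funext y
  by_cases hy : y ∈ Metric.ball (0 : EuclideanSpace ℝ (Fin n)) 1
  · rw [hwu]
    refine hsub ?_
    rw [Metric.mem_ball, dist_eq_norm, add_sub_cancel_left, norm_smul, Real.norm_eq_abs,
      abs_of_pos hr]
    have : ‖y‖ < 1 := by simpa using hy
    nlinarith
  · simp [weight_eq_zero hy]

theorem abs_integral_weight_le {f : EuclideanSpace ℝ (Fin n) → ℝ} {x : EuclideanSpace ℝ (Fin n)}
    {r : ℝ} (hr : 0 < r) (hf : IntegrableOn f (Metric.ball x r)) :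
    |∫ y, weight y * f (x + r • y)| ≤ (r ^ n)⁻¹ * ∫ z in Metric.ball x r, |f z| := by
  set g : EuclideanSpace ℝ (Fin n) → ℝ := (Metric.ball x r).indicator fun z => |f z| with hg
  have hgi : Integrable g := (integrable_indicator_iff measurableSet_ball).2 hf.abs
  have hgi' : Integrable (fun y => g (x + r • y)) :=
    (hgi.comp_add_left x).comp_smul hr.ne'
  have e : ∫ y, g (x + r • y) = (r ^ n)⁻¹ * ∫ z in Metric.ball x r, |f z| := by
    have h1 := Measure.integral_comp_smul (volume : Measure (EuclideanSpace ℝ (Fin n)))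
      (fun z => g (x + z)) r
    rw [h1, integral_add_left_eq_self, hg, integral_indicator measurableSet_ball,
      finrank_euclideanSpace_fin, abs_of_pos (by positivity), smul_eq_mul]
  rw [← e, ← Real.norm_eq_abs]
  refine norm_integral_le_of_norm_le hgi' (Eventually.of_forall fun y => ?_)
  rw [norm_mul, Real.norm_eq_abs, abs_of_nonneg (weight_nonneg y), Real.norm_eq_abs]
  by_cases hy : y ∈ Metric.ball (0 : EuclideanSpace ℝ (Fin n)) 1
  · have : x + r • y ∈ Metric.ball x r := by
      rw [Metric.mem_ball, dist_eq_norm, add_sub_cancel_left, norm_smul, Real.norm_eq_abs,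
        abs_of_pos hr]
      have : ‖y‖ < 1 := by simpa using hy
      nlinarith
    rw [hg, Set.indicator_of_mem this]
    nlinarith [weight_le_one y, abs_nonneg (f (x + r • y))]
  · rw [weight_eq_zero hy, zero_mul]
    exact Set.indicator_nonneg (fun _ _ => abs_nonneg _) _

end

/-! ### Necessary conditions at maxima and Hartogs' lemma -/

section

open Matrix

variable {n : ℕ}

theorem isHermitian_jetA (s : ℝ) (p : Fin n → ℝ) {H : Matrix (Fin n) (Fin n) ℝ} (hH : Hᵀ = H) :
    (jetA s p H).IsHermitian := by
  rw [IsHermitian, conjTranspose_eq_transpose_of_trivial]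
  simp [jetA, hH]

theorem isHermitian_schouten {u : EuclideanSpace ℝ (Fin n) → ℝ} {x : EuclideanSpace ℝ (Fin n)}
    (hu : ContDiffAt ℝ 2 u x) : (schouten u x).IsHermitian := by
  rw [schouten_eq_jetA]
  exact isHermitian_jetA _ _ (hessian_transpose hu)

theorem S_eq_sig {u : EuclideanSpace ℝ (Fin n) → ℝ} {x : EuclideanSpace ℝ (Fin n)}
    (hu : ContDiffAt ℝ 2 u x) (m : ℕ) :
    S m u x = sig m (jetA (u x) (grad u x) (hessian u x)) := by
  rw [S, esymm_eigenvalues (isHermitian_schouten hu), schouten_eq_jetA]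

theorem sig_one (A : Matrix (Fin n) (Fin n) ℝ) : sig 1 A = A.trace := by
  have := trace_newton_mul 0 A
  simpa [newton_zero] using this.symm

/-- Functions in the class `PhiTilde k` with `k ≥ 1` are subharmonic. -/
theorem trace_hessian_nonneg {k : ℕ} (hk : 1 ≤ k) {Ω : Set (EuclideanSpace ℝ (Fin n))}
    (hΩ : IsOpen Ω) {u : EuclideanSpace ℝ (Fin n) → ℝ} (hu : u ∈ PhiTilde k Ω) :
    ∀ x ∈ Ω, 0 ≤ (hessian u x).trace := by
  intro x hx
  obtain ⟨h1, h2, h3⟩ := hu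
  have hc : ContDiffAt ℝ 2 u x := h1.contDiffAt (hΩ.mem_nhds hx)
  have h4 := (mem_gardingCone_iff (isHermitian_schouten hc) k).1 (h3 x hx) 1 le_rfl hk
  rw [sig_one, schouten_eq_jetA, jetA, trace_sub, trace_smul, trace_smul, trace_one] at h4
  have h5 : 0 ≤ grad u x ⬝ᵥ grad u x := Finset.sum_nonneg fun i _ => mul_self_nonneg _
  have h6 : (0 : ℝ) ≤ Fintype.card (Fin n) := Nat.cast_nonneg _
  simp only [smul_eq_mul] at h4
  have h7 : 0 ≤ u x * (hessian u x).trace := by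
    nlinarith [mul_nonneg h5 h6]
  exact nonneg_of_mul_nonneg_right h7 (h2 x hx)

theorem integrable_weight_comp {f : EuclideanSpace ℝ (Fin n) → ℝ} {x : EuclideanSpace ℝ (Fin n)}
    {r : ℝ} (hr : 0 < r) (hf : ContinuousOn f (Metric.closedBall x r)) :
    Integrable (fun y => weight y * f (x + r • y)) := by
  have hs : Function.support (fun y => weight y * f (x + r • y))
      ⊆ Metric.closedBall (0 : EuclideanSpace ℝ (Fin n)) 1 := by
    intro y hy
    by_contra h
    exact hy (by simp [weight_eq_zero fun h' => h (Metric.ball_subset_closedBall h')])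
  rw [← integrableOn_iff_integrable_of_support_subset hs]
  refine ContinuousOn.integrableOn_compact (isCompact_closedBall _ _) ?_
  refine continuous_weight.continuousOn.mul (hf.comp (by fun_prop) fun y hy => ?_)
  rw [Metric.mem_closedBall, dist_eq_norm, add_sub_cancel_left, norm_smul, Real.norm_eq_abs,
    abs_of_pos hr]
  have : ‖y‖ ≤ 1 := by simpa using hy
  nlinarith

theorem tendsto_integral_abs {f : ℕ → EuclideanSpace ℝ (Fin n) → ℝ}
    {K : Set (EuclideanSpace ℝ (Fin n))} (hK : IsCompact K) (hf : ∀ m, ContinuousOn (f m) K)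
    (h : Tendsto (fun m => eLpNorm (f m) 1 (volume.restrict K)) atTop (𝓝 0)) :
    Tendsto (fun m => ∫ x in K, |f m x|) atTop (𝓝 0) := by
  have h1 := (ENNReal.tendsto_toReal ENNReal.zero_ne_top).comp h
  simp only [ENNReal.toReal_zero] at h1
  refine h1.congr fun m => ?_
  have := integral_norm_eq_lintegral_enorm ((hf m).aestronglyMeasurable_of_isCompact hK
    hK.measurableSet (μ := volume))
  simp only [Function.comp, eLpNorm_one_eq_lintegral_enorm, ← this, Real.norm_eq_abs]

/-- Convergence in `L¹_loc` of functions in `PhiTilde k` to a continuous limit gives a locally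
uniform upper bound, by the mean value inequality (Hartogs' lemma). -/
theorem eventually_le_add {k : ℕ} (hk : 1 ≤ k) {v : ℕ → EuclideanSpace ℝ (Fin n) → ℝ}
    {u : EuclideanSpace ℝ (Fin n) → ℝ} (hu : ContinuousOn u (Metric.ball 0 3))
    (hv : ∀ m, v m ∈ PhiTilde k (Metric.ball 0 3))
    (hlim : ∀ K : Set (EuclideanSpace ℝ (Fin n)), IsCompact K → K ⊆ Metric.ball 0 3 →
      Tendsto (fun m => ∫ x in K, |v m x - u x|) atTop (𝓝 0))
    {R τ : ℝ} (hR : R < 3) (hτ : 0 < τ) :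
    ∀ᶠ m in atTop, ∀ x ∈ Metric.closedBall 0 R, v m x ≤ u x + τ := by
  set c := ∫ y, weight (n := n) y with hc
  have hcpos : 0 < c := integral_weight_pos
  set R' := (R + 3) / 2 with hR'
  have hsub : Metric.closedBall (0 : EuclideanSpace ℝ (Fin n)) R' ⊆ Metric.ball 0 3 :=
    Metric.closedBall_subset_ball (by linarith)
  have hKc : IsCompact (Metric.closedBall (0 : EuclideanSpace ℝ (Fin n)) R') :=
    isCompact_closedBall _ _
  have huc := hKc.uniformContinuousOn_of_continuous (hu.mono hsub)
  obtain ⟨δ, hδ, hδu⟩ := Metric.uniformContinuousOn_iff.1 huc (τ / 2) (by positivity)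
  obtain ⟨r, hr0, hrδ, hrR⟩ : ∃ r : ℝ, 0 < r ∧ r < δ ∧ R + r < R' := by
    refine ⟨min (δ / 2) ((3 - R) / 4), lt_min (by linarith) (by linarith), ?_, ?_⟩
    · exact lt_of_le_of_lt (min_le_left _ _) (by linarith)
    · have := min_le_right (δ / 2) ((3 - R) / 4)
      linarith
  have hev := (hlim _ hKc hsub).eventually (gt_mem_nhds
    (show 0 < r ^ n * (c * (τ / 2)) by positivity))
  filter_upwards [hev] with m hm x hx
  obtain ⟨hvc, hvpos, -⟩ := hv m
  have hx' : ‖x‖ ≤ R := by simpa using hx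
  have hball : Metric.closedBall x r ⊆ Metric.closedBall 0 R' :=
    Metric.closedBall_subset_closedBall' (by rw [dist_zero_right]; linarith)
  have hucx := hu.mono (hball.trans hsub)
  have hvcx := hvc.continuousOn.mono (hball.trans hsub)
  have h1 := mean_value_weight hvc hvpos (trace_hessian_nonneg hk Metric.isOpen_ball (hv m)) hr0
    (show ‖x‖ + r < 3 by linarith)
  have h2 : ∫ y, weight y * v m (x + r • y) = (∫ y, weight y * u (x + r • y))
      + ∫ y, weight y * (v m (x + r • y) - u (x + r • y)) := by
    rw [← integral_add (integrable_weight_comp hr0 hucx)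
      (integrable_weight_comp (f := fun z => v m z - u z) hr0 (hvcx.sub hucx))]
    congr 1; funext y; ring
  have h3 : ∫ y, weight y * u (x + r • y) ≤ c * (u x + τ / 2) := by
    rw [hc, ← integral_mul_const]
    refine integral_mono (integrable_weight_comp hr0 hucx)
      ((continuous_weight.integrable_of_hasCompactSupport hasCompactSupport_weight).mul_const _)
      fun y => ?_
    by_cases hy : y ∈ Metric.ball (0 : EuclideanSpace ℝ (Fin n)) 1
    · refine mul_le_mul_of_nonneg_left ?_ (weight_nonneg y)
      have hd : dist (x + r • y) x < r := by
        rw [dist_eq_norm, add_sub_cancel_left, norm_smul, Real.norm_eq_abs, abs_of_pos hr0]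
        have : ‖y‖ < 1 := by simpa using hy
        nlinarith
      have := hδu (x + r • y) (hball (Metric.mem_closedBall.2 hd.le)) x
        (hball (Metric.mem_closedBall_self hr0.le)) (hd.trans hrδ)
      rw [Real.dist_eq] at this
      linarith [(abs_lt.1 this).2]
    · simp [weight_eq_zero hy]
  have hion : IntegrableOn (fun z => v m z - u z) (Metric.closedBall 0 R') :=
    ((hvc.continuousOn.mono hsub).sub (hu.mono hsub)).integrableOn_compact hKc
  have h4 := abs_integral_weight_le (f := fun z => v m z - u z) (x := x) hr0
    (hion.mono_set (Metric.ball_subset_closedBall.trans hball))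
  have h5 : ∫ z in Metric.ball x r, |v m z - u z| ≤ ∫ z in Metric.closedBall 0 R', |v m z - u z| :=
    setIntegral_mono_set hion.abs (Eventually.of_forall fun z => abs_nonneg _)
      (Metric.ball_subset_closedBall.trans hball).eventuallyLE
  have h6 : (r ^ n)⁻¹ * ∫ z in Metric.ball x r, |v m z - u z| ≤ c * (τ / 2) := by
    rw [inv_mul_le_iff₀ (by positivity)]
    exact h5.trans hm.le
  have h7 : c * v m x ≤ c * (u x + τ) := by
    have := (le_abs_self _).trans (h4.trans h6)
    linarith
  exact le_of_mul_le_mul_left h7 hcpos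

theorem fderiv_fderiv_apply_eq_sum (f : EuclideanSpace ℝ (Fin n) → ℝ)
    (x : EuclideanSpace ℝ (Fin n)) (ξ : EuclideanSpace ℝ (Fin n)) :
    fderiv ℝ (fderiv ℝ f) x ξ ξ = (fun i => ξ i) ⬝ᵥ (hessian f x *ᵥ fun i => ξ i) := by
  have : ξ = ∑ i, ξ i • EuclideanSpace.single i (1 : ℝ) := by
    ext j; simp [Finset.sum_apply, Pi.single_apply]
  conv_lhs => rw [this]
  simp only [map_sum, map_smul, _root_.sum_apply, _root_.smul_apply,
    smul_eq_mul, dotProduct, mulVec, hessian, Matrix.of_apply, Finset.mul_sum]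
  rw [Finset.sum_comm]
  refine Finset.sum_congr rfl fun i _ => Finset.sum_congr rfl fun j _ => by ring

/-- First and second order necessary conditions at an interior maximum. -/
theorem grad_hessian_of_isLocalMax {f : EuclideanSpace ℝ (Fin n) → ℝ} {x : EuclideanSpace ℝ (Fin n)}
    (h : IsLocalMax f x) (hf : ContDiffAt ℝ 2 f x) :
    grad f x = 0 ∧ (-hessian f x).PosSemidef := by
  have hd : fderiv ℝ f x = 0 := h.fderiv_eq_zero
  refine ⟨by funext i; simp [grad, hd], PosSemidef.of_dotProduct_mulVec_nonneg ?_ ?_⟩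
  · rw [IsHermitian, conjTranspose_eq_transpose_of_trivial, transpose_neg, hessian_transpose hf]
  intro ξ
  set e : EuclideanSpace ℝ (Fin n) := WithLp.toLp 2 ξ with he
  have hq := fderiv_fderiv_apply_eq_sum f x e
  suffices hle : fderiv ℝ (fderiv ℝ f) x e e ≤ 0 by
    rw [hq] at hle
    rw [star_trivial, neg_mulVec, dotProduct_neg]
    simp only [he] at hle
    linarith
  by_contra hpos
  push Not at hpos
  have hev : ∀ᶠ y in 𝓝 x, DifferentiableAt ℝ f y := by
    filter_upwards [hf.eventually (by simp)] with y hy using hy.differentiableAt (by simp)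
  have hline : Tendsto (fun t : ℝ => x + t • e) (𝓝 0) (𝓝 x) := by
    have : ContinuousAt (fun t : ℝ => x + t • e) 0 := by fun_prop
    simpa [ContinuousAt] using this
  have hderiv : deriv (fun t : ℝ => f (x + t • e)) =ᶠ[𝓝 0] fun t => fderiv ℝ f (x + t • e) e := by
    filter_upwards [hline.eventually hev] with t ht
    have h1 : HasDerivAt (fun s : ℝ => x + s • e) e t := by
      simpa using ((hasDerivAt_id t).smul_const e).const_add x
    exact (ht.hasFDerivAt.comp_hasDerivAt t h1).deriv
  have hdd : deriv (deriv (fun t : ℝ => f (x + t • e))) 0 = fderiv ℝ (fderiv ℝ f) x e e := by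
    rw [hderiv.deriv_eq]
    have h1 : DifferentiableAt ℝ (fderiv ℝ f) x :=
      (hf.fderiv_right (m := 1) (by norm_num)).differentiableAt (by simp)
    have h2 := (hasDerivAt_line h1 e)
    exact (((ContinuousLinearMap.apply ℝ ℝ e).hasFDerivAt.comp_hasDerivAt (0 : ℝ) h2)).deriv
  have hmax : IsLocalMax (fun t : ℝ => f (x + t • e)) 0 := by
    have := hline.eventually h
    simpa [IsLocalMax, IsMaxFilter] using this
  have hmin : IsLocalMin (fun t : ℝ => f (x + t • e)) 0 := by
    -- a positive second derivative would make `0` a strict minimum as well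
    refine isLocalMin_of_deriv_deriv_pos (by rw [hdd]; exact hpos) hmax.deriv_eq_zero ?_
    have : ContinuousAt f (x + (0 : ℝ) • e) := by simpa using hf.continuousAt
    exact ContinuousAt.comp (f := fun t : ℝ => x + t • e) this (by fun_prop)
  have hconst : (fun t : ℝ => f (x + t • e)) =ᶠ[𝓝 0] fun _ => f (x + (0 : ℝ) • e) := by
    filter_upwards [hmax, hmin] with t h1 h2 using le_antisymm h1 h2
  have h0 : deriv (deriv (fun t : ℝ => f (x + t • e))) 0 = 0 := by
    rw [hconst.deriv.deriv_eq]
    simp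
  rw [hdd] at h0
  exact hpos.ne' h0

theorem grad_hessian_sub {f g : EuclideanSpace ℝ (Fin n) → ℝ} {x : EuclideanSpace ℝ (Fin n)}
    (hf : ContDiffAt ℝ 2 f x) (hg : ContDiffAt ℝ 2 g x) :
    grad (fun y => f y - g y) x = grad f x - grad g x ∧
      hessian (fun y => f y - g y) x = hessian f x - hessian g x := by
  have h1 : fderiv ℝ (fun y => f y - g y) =ᶠ[𝓝 x] fun y => fderiv ℝ f y - fderiv ℝ g y := by
    filter_upwards [hf.eventually (by simp), hg.eventually (by simp)] with y h1 h2
    exact fderiv_fun_sub (h1.differentiableAt (by simp)) (h2.differentiableAt (by simp))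
  have h2 : fderiv ℝ (fderiv ℝ (fun y => f y - g y)) x
      = fderiv ℝ (fderiv ℝ f) x - fderiv ℝ (fderiv ℝ g) x := by
    rw [h1.fderiv_eq]
    exact fderiv_fun_sub
      ((hf.fderiv_right (m := 1) (by norm_num)).differentiableAt (by simp))
      ((hg.fderiv_right (m := 1) (by norm_num)).differentiableAt (by simp))
  constructor
  · funext i; simp [grad, h1.eq_of_nhds]
  · ext i j; simp [hessian, h2]

theorem grad_hessian_add_mul_sq {w : EuclideanSpace ℝ (Fin n) → ℝ} (hw : ContDiff ℝ 2 w) (ε : ℝ)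
    (x₀ x : EuclideanSpace ℝ (Fin n)) :
    grad (fun y => w y + ε * ‖y - x₀‖ ^ 2) x = (grad w x + fun i => 2 * ε * (x i - x₀ i)) ∧
      hessian (fun y => w y + ε * ‖y - x₀‖ ^ 2) x
        = hessian w x + (2 * ε) • (1 : Matrix (Fin n) (Fin n) ℝ) := by
  have hq : ∀ y, HasFDerivAt (fun y : EuclideanSpace ℝ (Fin n) => ε * ‖y - x₀‖ ^ 2)
      (ε • (2 • innerSL ℝ (y - x₀))) y := by
    intro y
    have h1 := (hasStrictFDerivAt_norm_sq (y - x₀)).hasFDerivAt.comp y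
      ((hasFDerivAt_id y).sub_const x₀)
    exact h1.const_mul ε
  have hd : fderiv ℝ (fun y => w y + ε * ‖y - x₀‖ ^ 2)
      = fun y => fderiv ℝ w y + ε • (2 • innerSL ℝ (y - x₀)) := by
    funext y
    exact ((hw.differentiable (by simp) y).hasFDerivAt.add (hq y)).fderiv
  have hin : HasFDerivAt (fun y : EuclideanSpace ℝ (Fin n) => ε • (2 • innerSL ℝ (y - x₀)))
      (ε • (2 • (innerSL ℝ : EuclideanSpace ℝ (Fin n) →L[ℝ] EuclideanSpace ℝ (Fin n) →L[ℝ] ℝ)))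
      x := by
    have h1 := ((innerSL ℝ : EuclideanSpace ℝ (Fin n) →L[ℝ] EuclideanSpace ℝ (Fin n) →L[ℝ] ℝ)
      |>.hasFDerivAt (x := x - x₀)).comp x ((hasFDerivAt_id x).sub_const x₀)
    exact (h1.const_smul 2).const_smul ε
  have hdd : fderiv ℝ (fderiv ℝ (fun y => w y + ε * ‖y - x₀‖ ^ 2)) x = fderiv ℝ (fderiv ℝ w) x
      + ε • (2 • (innerSL ℝ : EuclideanSpace ℝ (Fin n) →L[ℝ] EuclideanSpace ℝ (Fin n) →L[ℝ] ℝ)) := by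
    rw [hd]
    exact ((((hw.fderiv_right (m := 1) (by norm_num)).differentiable (by simp) x).hasFDerivAt).add
      hin).fderiv
  constructor
  · funext i
    simp only [grad, hd, Pi.add_apply, _root_.add_apply, _root_.smul_apply,
      innerSL_apply_apply, EuclideanSpace.inner_single_right]
    simp
    ring
  · ext i j
    rw [hessian, Matrix.of_apply, hdd]
    change hessian w x i j + ε • (2 • inner ℝ (EuclideanSpace.single i (1 : ℝ))
      (EuclideanSpace.single j (1 : ℝ))) = _
    rw [EuclideanSpace.inner_single_right]
    by_cases h : i = j
    · subst h; simp; ring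
    · simp [h, Matrix.one_apply_ne]

end

/-! ### `C²` limits stay in the class -/

section

open Matrix

variable {n : ℕ}

/-- The 2-jet of a function touching a function of the class from above lies in the cone. -/
theorem sig_nonneg_of_touching {k : ℕ} {v : EuclideanSpace ℝ (Fin n) → ℝ}
    {x : EuclideanSpace ℝ (Fin n)} (hv : ContDiffAt ℝ 2 v x) (hpos : 0 < v x)
    (hcone : eigenvalues (schouten v x) ∈ gardingCone k) {φ : EuclideanSpace ℝ (Fin n) → ℝ}
    (hφ : ContDiffAt ℝ 2 φ x) (hmax : IsLocalMax (fun y => v y - φ y) x) {i : ℕ} (hi : 1 ≤ i)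
    (hik : i ≤ k) : 0 ≤ sig i (jetA (v x) (grad φ x) (hessian φ x)) := by
  obtain ⟨h1, h2⟩ := grad_hessian_of_isLocalMax hmax (hv.sub hφ)
  obtain ⟨h3, h4⟩ := grad_hessian_sub hv hφ
  rw [h3] at h1
  rw [h4, neg_sub] at h2
  have h5 : grad φ x = grad v x := (sub_eq_zero.1 h1).symm
  have h6 : jetA (v x) (grad φ x) (hessian φ x)
      = schouten v x + v x • (hessian φ x - hessian v x) := by
    rw [schouten_eq_jetA, h5, jetA, jetA, smul_sub]
    abel
  refine (mem_gardingCone_iff (isHermitian_jetA _ _ (hessian_transpose hφ)) k).1 ?_ i hi hik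
  rw [h6]
  exact mem_gardingCone_add_posSemidef (isHermitian_schouten hv) hcone (h2.smul hpos.le)

/-- A `C²` limit in `L¹_loc` of functions in `PhiTilde k` belongs to `PhiTilde k`: otherwise a
perturbation of the limit would touch an approximating function from above at a point where its
2-jet is not admissible. -/
theorem mem_phiTilde {k : ℕ} (hk : 1 ≤ k) {u : EuclideanSpace ℝ (Fin n) → ℝ}
    (hu : u ∈ Phi k (Metric.ball 0 3)) (hu2 : ContDiffOn ℝ 2 u (Metric.ball 0 3)) :
    u ∈ PhiTilde k (Metric.ball 0 3) := by
  obtain ⟨-, hpos, v, hv, hlim⟩ := hu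
  refine ⟨hu2, hpos, fun x₀ hx₀ => ?_⟩
  have hlim' : ∀ K : Set (EuclideanSpace ℝ (Fin n)), IsCompact K → K ⊆ Metric.ball 0 3 →
      Tendsto (fun m => ∫ x in K, |v m x - u x|) atTop (𝓝 0) := fun K hK hKs =>
    tendsto_integral_abs hK (fun m => ((hv m).1.continuousOn.mono hKs).sub
      (hu2.continuousOn.mono hKs)) (hlim K hK hKs)
  have hu2x : ContDiffAt ℝ 2 u x₀ := hu2.contDiffAt (Metric.isOpen_ball.mem_nhds hx₀)
  rw [mem_gardingCone_iff (isHermitian_schouten hu2x)]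
  intro i hi hik
  by_contra hneg
  push Not at hneg
  have hx₀' : ‖x₀‖ < 3 := by simpa using hx₀
  have hx₀0 := norm_nonneg x₀
  set R := (‖x₀‖ + 3) / 2 with hR
  obtain ⟨w, hw, hwpos, -, hwu⟩ := exists_extension hu2 hpos (R := R) (by linarith) (by linarith)
  have hw1 : ContDiff ℝ 1 w := hw.of_le (by norm_num)
  have hwe : u =ᶠ[𝓝 x₀] w := by
    filter_upwards [Metric.isOpen_ball.mem_nhds (show x₀ ∈ Metric.ball 0 R by
      rw [Metric.mem_ball, dist_zero_right]; linarith)] with y hy using (hwu y hy).symm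
  rw [schouten_eq_jetA, hwe.eq_of_nhds, grad_congr hwe, hessian_congr hwe] at hneg
  -- the perturbed 2-jet stays outside the cone for small parameters
  set Ψ : ℝ × ℝ × EuclideanSpace ℝ (Fin n) → ℝ := fun y =>
    sig i (jetA (w y.2.2 + y.1 * ‖y.2.2 - x₀‖ ^ 2 + y.2.1)
      (grad w y.2.2 + fun j => 2 * y.1 * (y.2.2 j - x₀ j))
      (hessian w y.2.2 + (2 * y.1) • (1 : Matrix (Fin n) (Fin n) ℝ))) with hΨ
  have hΨc : Continuous Ψ := by
    refine (continuous_newton_sig i).2.comp (continuous_jetA.comp (Continuous.prodMk ?_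
      (Continuous.prodMk ?_ ?_)))
    · have := hw.continuous
      fun_prop
    · exact ((continuous_grad hw1).comp (by fun_prop)).add (by fun_prop)
    · exact ((continuous_hessian hw).comp (by fun_prop)).add
        ((by fun_prop : Continuous fun y : ℝ × ℝ × EuclideanSpace ℝ (Fin n) =>
          2 * y.1).smul continuous_const)
  have hΨ0 : Ψ (0, 0, x₀) < 0 := by
    have e : (fun j => 2 * (0 : ℝ) * (x₀ j - x₀ j)) = 0 := by funext j; simp
    simp only [hΨ, e]
    simpa using hneg
  obtain ⟨δ, hδ, hδΨ⟩ := Metric.eventually_nhds_iff.1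
    (hΨc.continuousAt.eventually_lt continuousAt_const hΨ0)
  set ε := δ / 2 with hε
  have hε0 : 0 < ε := by positivity
  obtain ⟨r, hr0, hr1, hrδ, hrR⟩ : ∃ r : ℝ, 0 < r ∧ r ≤ 1 ∧ r ≤ ε ∧ ‖x₀‖ + r < R := by
    refine ⟨min (min 1 ε) ((3 - ‖x₀‖) / 4), lt_min (lt_min one_pos hε0) (by linarith),
      (min_le_left _ _).trans (min_le_left _ _), (min_le_left _ _).trans (min_le_right _ _), ?_⟩
    have := min_le_right (min 1 ε) ((3 - ‖x₀‖) / 4)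
    linarith
  -- `τ` is small enough that the maximum below cannot lie on the sphere of radius `r`
  set τ := ε * r ^ 2 / 4 with hτ
  have hτ0 : 0 < τ := by positivity
  have hb1 : Metric.closedBall x₀ r ⊆ Metric.closedBall 0 (‖x₀‖ + r) :=
    Metric.closedBall_subset_closedBall' (by rw [dist_zero_right]; linarith)
  have hb2 : Metric.closedBall x₀ r ⊆ Metric.ball 0 R :=
    hb1.trans (Metric.closedBall_subset_ball hrR)
  have hb3 : Metric.closedBall x₀ r ⊆ Metric.ball 0 3 :=
    hb2.trans (Metric.ball_subset_ball (by linarith))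
  have hb4 : Metric.closedBall x₀ (r / 2) ⊆ Metric.closedBall x₀ r :=
    Metric.closedBall_subset_closedBall (by linarith)
  have hvol : 0 < volume.real (Metric.closedBall x₀ (r / 2)) :=
    ENNReal.toReal_pos (Metric.measure_closedBall_pos _ _ (by positivity)).ne'
      (isCompact_closedBall _ _).measure_lt_top.ne
  have hE1 := eventually_le_add hk hu2.continuousOn hv hlim' (R := ‖x₀‖ + r) (by linarith) hτ0
  have hE2 := (hlim' _ (isCompact_closedBall x₀ (r / 2)) (hb4.trans hb3)).eventually
    (gt_mem_nhds (show 0 < τ * volume.real (Metric.closedBall x₀ (r / 2)) by positivity))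
  obtain ⟨m, hm1, hm2⟩ := (hE1.and hE2).exists
  obtain ⟨hvc, hvpos, hvcone⟩ := hv m
  -- near `x₀` the function `v m` is not far below `u`
  obtain ⟨y, hy, hyv⟩ : ∃ y ∈ Metric.closedBall x₀ (r / 2), -τ ≤ v m y - u y := by
    by_contra hcon
    push Not at hcon
    have hion : IntegrableOn (fun z => |v m z - u z|) (Metric.closedBall x₀ (r / 2)) :=
      (((hvc.continuousOn.mono (hb4.trans hb3)).sub
        (hu2.continuousOn.mono (hb4.trans hb3))).integrableOn_compact
          (isCompact_closedBall _ _)).abs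
    have := setIntegral_mono_on (f := fun _ => τ) (g := fun z => |v m z - u z|)
      (integrableOn_const (isCompact_closedBall x₀ (r / 2)).measure_lt_top.ne) hion
      Metric.isClosed_closedBall.measurableSet fun z hz => by
        have := hcon z hz
        have := neg_le_abs (v m z - u z)
        linarith
    rw [setIntegral_const, smul_eq_mul, mul_comm] at this
    linarith
  set φ : EuclideanSpace ℝ (Fin n) → ℝ := fun y => w y + ε * ‖y - x₀‖ ^ 2 with hφ
  have hφc : ContDiff ℝ 2 φ :=
    hw.add (contDiff_const.mul ((contDiff_id.sub contDiff_const).norm_sq ℝ))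
  obtain ⟨xm, hxm, hmax⟩ := (isCompact_closedBall x₀ r).exists_isMaxOn
    (Metric.nonempty_closedBall.2 hr0.le)
    ((hvc.continuousOn.mono hb3).sub hφc.continuous.continuousOn)
  have hmaxle : ∀ z ∈ Metric.closedBall x₀ r, v m z - φ z ≤ v m xm - φ xm := fun z hz => hmax hz
  have hup : v m xm - w xm ≤ τ := by
    have := hm1 xm (hb1 hxm)
    rw [hwu xm (hb2 hxm)]
    linarith
  have hlow : -τ - ε * (r / 2) ^ 2 ≤ v m xm - φ xm := by
    refine le_trans ?_ (hmaxle y (hb4 hy))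
    have h1 : ‖y - x₀‖ ≤ r / 2 := by rw [← dist_eq_norm]; exact hy
    have h2 : ‖y - x₀‖ ^ 2 ≤ (r / 2) ^ 2 := pow_le_pow_left₀ (norm_nonneg _) h1 2
    simp only [hφ]
    rw [hwu y (hb2 (hb4 hy))]
    nlinarith
  have hint : xm ∈ Metric.ball x₀ r := by
    rw [Metric.mem_ball]
    refine lt_of_le_of_ne hxm fun heq => ?_
    rw [dist_eq_norm] at heq
    simp only [hφ, heq] at hlow
    nlinarith
  have hloc : IsLocalMax (fun z => v m z - φ z) xm := by
    filter_upwards [Metric.isOpen_ball.mem_nhds hint] with z hz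
      using hmaxle z (Metric.ball_subset_closedBall hz)
  have hxm3 := hb3 hxm
  have htouch := sig_nonneg_of_touching
    (hvc.contDiffAt (Metric.isOpen_ball.mem_nhds hxm3)) (hvpos xm hxm3) (hvcone xm hxm3)
    hφc.contDiffAt hloc hi hik
  obtain ⟨hg, hh⟩ := grad_hessian_add_mul_sq hw ε x₀ xm
  rw [hg, hh] at htouch
  have hval : v m xm = w xm + ε * ‖xm - x₀‖ ^ 2 + (v m xm - φ xm) := by
    simp only [hφ]; ring
  rw [hval] at htouch
  have hr2 : r ^ 2 ≤ 1 := by nlinarith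
  have hlt := hδΨ (y := (ε, v m xm - φ xm, xm)) (by
    rw [Prod.dist_eq, Prod.dist_eq, max_lt_iff, max_lt_iff]
    refine ⟨?_, ?_, ?_⟩
    · rw [dist_zero_right, Real.norm_eq_abs, abs_of_pos hε0]
      linarith
    · rw [dist_zero_right, Real.norm_eq_abs, abs_lt]
      have : v m xm - φ xm ≤ τ := by
        simp only [hφ]
        nlinarith [sq_nonneg ‖xm - x₀‖]
      constructor <;> nlinarith
    · exact lt_of_lt_of_le (Metric.mem_ball.1 hint) (by linarith))
  exact absurd hlt (not_lt.2 htouch)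

end

/-! ### Weights and the pointwise energy inequality -/

section

open Matrix

variable {n : ℕ}

theorem exists_pos_forall_le {f : ℕ → ℝ} (k : ℕ) (hf : ∀ i < k, 0 < f i) :
    ∃ δ > 0, ∀ i < k, δ ≤ f i := by
  induction k with
  | zero => exact ⟨1, one_pos, fun i hi => by omega⟩
  | succ k ih =>
    obtain ⟨δ, hδ, h⟩ := ih fun i hi => hf i (by omega)
    refine ⟨min δ (f k), lt_min hδ (hf k (by omega)), fun i hi => ?_⟩
    rcases Nat.lt_succ_iff_lt_or_eq.1 hi with h' | rfl
    · exact (min_le_left _ _).trans (h i h')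
    · exact min_le_right _ _

/-- The integrated divergence formulas for `T_0, …, T_{k-1}` have a positive linear combination in
which all the nonnegative quantities `X_m = ∫ u^α |∇u|^{2(k-m)} σ_m` and
`Y_i = ∫ u^α |∇u|^{2(k-1-i)} T_i(∇u, ∇u)` occur with positive coefficients. The admissible range
for the ratio of consecutive weights is nonempty because `α + 2k > 0` and `2k ≤ n`. -/
theorem exists_weights (n : ℕ) {k : ℕ} (hk : 1 ≤ k) (hkn : 2 * k ≤ n) {α : ℝ}
    (hα : 0 < α + 2 * (k : ℝ)) :
    ∃ (c : ℕ → ℝ) (δ : ℝ), (∀ i < k, 0 < c i) ∧ 0 < δ ∧ ∀ X Y : ℕ → ℝ, (∀ m ≤ k, 0 ≤ X m) →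
      (∀ i < k, 0 ≤ Y i) → X 0 = Y 0 →
      δ * (∑ m ∈ Finset.range (k + 1), X m + ∑ i ∈ Finset.range k, Y i) ≤
        ∑ i ∈ Finset.range k, c i * ((2 * k - 1 - i) * X (i + 1) - (n - i) / 2 * X i
          + (α + n + k - i) * Y i - 2 * (k - 1 - i) * Y (i + 1)) := by
  obtain ⟨K, rfl⟩ := Nat.exists_eq_add_of_le' hk
  have hn : (2 * (K + 1) : ℝ) ≤ n := by exact_mod_cast hkn
  push_cast at hα ⊢
  set lo : ℕ → ℝ := fun i => 2 * (K - i) / (α + n + K - i) with hlo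
  set hi : ℕ → ℝ := fun i => 2 * (2 * K + 1 - i) / (n - i - 1) with hhi
  have hcast : ∀ i < K, (i : ℝ) + 1 ≤ K := fun i hi => by exact_mod_cast hi
  have hd1 : ∀ i < K, 0 < α + n + K - i := fun i hi => by
    have := hcast i hi; linarith
  have hd2 : ∀ i < K, (0 : ℝ) < n - i - 1 := fun i hi => by
    have := hcast i hi
    have : (0 : ℝ) ≤ i := Nat.cast_nonneg i
    linarith
  have hlohi : ∀ i < K, lo i < hi i := by
    intro i hiK
    have h1 := hcast i hiK
    have h0 : (0 : ℝ) ≤ i := Nat.cast_nonneg i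
    rw [hlo, hhi]
    simp only
    rw [div_lt_div_iff₀ (hd1 i hiK) (hd2 i hiK)]
    have e1 : 0 < (2 * K + 1 - i) * (α + 2 * (K + 1)) := mul_pos (by linarith) hα
    have e2 : 0 ≤ ((K : ℝ) + 1) * (n - 2 * (K + 1)) := mul_nonneg (by linarith) (by linarith)
    nlinarith
  have hlo0 : ∀ i < K, 0 < lo i := fun i hiK => by
    have := hcast i hiK
    exact div_pos (by linarith) (hd1 i hiK)
  set c : ℕ → ℝ := fun i => ∏ j ∈ Finset.range i, (lo j + hi j) / 2 with hc
  have hcs : ∀ i, c (i + 1) = c i * ((lo i + hi i) / 2) := fun i => Finset.prod_range_succ _ _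
  have hcpos : ∀ i < K + 1, 0 < c i := by
    intro i hiK
    refine Finset.prod_pos fun j hj => ?_
    have hjK : j < K := by have := Finset.mem_range.1 hj; omega
    have := hlo0 j hjK
    have := hlohi j hjK
    linarith
  set a : ℕ → ℝ := fun i => (2 * K + 1 - i) * c i - (n - i - 1) / 2 * c (i + 1) with ha
  set b : ℕ → ℝ := fun i => (α + n + K - i) * c (i + 1) - 2 * (K - i) * c i with hb
  have hapos : ∀ i < K, 0 < a i := by
    intro i hiK
    have e1 : (n - i - 1) * hi i = 2 * (2 * K + 1 - i) := by
      rw [hhi]; field_simp [(hd2 i hiK).ne']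
    have e2 : (n - i - 1) * ((lo i + hi i) / 2) < 2 * (2 * K + 1 - i) := by
      rw [← e1]
      exact mul_lt_mul_of_pos_left (by linarith [hlohi i hiK]) (hd2 i hiK)
    have e3 : a i = c i / 2 * (2 * (2 * K + 1 - i) - (n - i - 1) * ((lo i + hi i) / 2)) := by
      simp only [ha, hcs]; ring
    rw [e3]
    exact mul_pos (half_pos (hcpos i (by omega))) (sub_pos.2 e2)
  have hbpos : ∀ i < K, 0 < b i := by
    intro i hiK
    have e1 : (α + n + K - i) * lo i = 2 * (K - i) := by
      rw [hlo]; field_simp [(hd1 i hiK).ne']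
    have e2 : 2 * (K - i) < (α + n + K - i) * ((lo i + hi i) / 2) := by
      rw [← e1]
      exact mul_lt_mul_of_pos_left (by linarith [hlohi i hiK]) (hd1 i hiK)
    have e3 : b i = c i * ((α + n + K - i) * ((lo i + hi i) / 2) - 2 * (K - i)) := by
      simp only [hb, hcs]; ring
    rw [e3]
    exact mul_pos (hcpos i (by omega)) (sub_pos.2 e2)
  obtain ⟨δ₁, hδ₁, h₁⟩ := exists_pos_forall_le K hapos
  obtain ⟨δ₂, hδ₂, h₂⟩ := exists_pos_forall_le K hbpos
  have hc0 : 0 < c 0 := hcpos 0 (by omega)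
  have hcK : 0 < c K := hcpos K (by omega)
  have hK0 : (0 : ℝ) ≤ K := Nat.cast_nonneg K
  -- the coefficient of `X_0 = Y_0`
  have hm : 0 < α + n / 2 + K + 1 := by linarith
  set δ := min (min δ₁ δ₂) (min (c 0 * (α + n / 2 + K + 1) / 2) (c K * (K + 1))) with hδ
  have hδ0 : 0 < δ := lt_min (lt_min hδ₁ hδ₂) (lt_min (by positivity) (by positivity))
  refine ⟨c, δ, hcpos, hδ0, fun X Y hX hY hXY => ?_⟩
  have hrhs : ∑ i ∈ Finset.range (K + 1), c i * ((2 * (K + 1 : ℝ) - 1 - i) * X (i + 1)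
      - (n - i) / 2 * X i + (α + n + (K + 1) - i) * Y i - 2 * ((K + 1) - 1 - i) * Y (i + 1))
      = c 0 * (α + n / 2 + K + 1) * X 0 + c K * (K + 1) * X (K + 1)
        + ∑ i ∈ Finset.range K, (a i * X (i + 1) + b i * Y (i + 1)) := by
    have e1 : ∑ i ∈ Finset.range (K + 1), c i * ((2 * (K + 1 : ℝ) - 1 - i) * X (i + 1)
        - (n - i) / 2 * X i + (α + n + (K + 1) - i) * Y i - 2 * ((K + 1) - 1 - i) * Y (i + 1))
        = (∑ i ∈ Finset.range (K + 1), c i * ((2 * K + 1 - i) * X (i + 1)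
            - 2 * (K - i) * Y (i + 1)))
          + ∑ i ∈ Finset.range (K + 1), c i * ((α + n + (K + 1) - i) * Y i - (n - i) / 2 * X i) := by
      rw [← Finset.sum_add_distrib]
      exact Finset.sum_congr rfl fun i _ => by ring
    rw [e1, Finset.sum_range_succ, Finset.sum_range_succ']
    have e2 : ∑ i ∈ Finset.range K, (a i * X (i + 1) + b i * Y (i + 1))
        = (∑ i ∈ Finset.range K, c i * ((2 * K + 1 - i) * X (i + 1) - 2 * (K - i) * Y (i + 1)))
          + ∑ i ∈ Finset.range K, c (i + 1) * ((α + n + (K + 1) - ((i + 1 : ℕ) : ℝ)) * Y (i + 1)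
            - (n - ((i + 1 : ℕ) : ℝ)) / 2 * X (i + 1)) := by
      rw [← Finset.sum_add_distrib]
      refine Finset.sum_congr rfl fun i _ => ?_
      simp only [ha, hb]
      push_cast
      ring
    rw [e2, ← hXY]
    push_cast
    ring
  have hlhs : ∑ m ∈ Finset.range (K + 1 + 1), X m + ∑ i ∈ Finset.range (K + 1), Y i
      = 2 * X 0 + X (K + 1) + ∑ i ∈ Finset.range K, (X (i + 1) + Y (i + 1)) := by
    rw [Finset.sum_range_succ, Finset.sum_range_succ' X, Finset.sum_range_succ' Y, ← hXY,
      Finset.sum_add_distrib]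
    ring
  rw [hrhs, hlhs, mul_add, mul_add, Finset.mul_sum]
  have hX0 := hX 0 (by omega)
  have hXK := hX (K + 1) le_rfl
  have d1 : δ ≤ δ₁ := (min_le_left _ _).trans (min_le_left _ _)
  have d2 : δ ≤ δ₂ := (min_le_left _ _).trans (min_le_right _ _)
  have d3 : δ ≤ c 0 * (α + n / 2 + K + 1) / 2 := (min_le_right _ _).trans (min_le_left _ _)
  have d4 : δ ≤ c K * (K + 1) := (min_le_right _ _).trans (min_le_right _ _)
  refine add_le_add (add_le_add ?_ (mul_le_mul_of_nonneg_right d4 hXK))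
    (Finset.sum_le_sum fun i hi => ?_)
  · nlinarith
  · have hiK := Finset.mem_range.1 hi
    rw [mul_add]
    exact add_le_add
      (mul_le_mul_of_nonneg_right (d1.trans (h₁ i hiK)) (hX _ (by omega)))
      (mul_le_mul_of_nonneg_right (d2.trans (h₂ i hiK)) (hY _ (by omega)))

/-- The integrand `∑_m s^α |p|^{2(k-m)} σ_m(A)` as a function of the 2-jet. -/
noncomputable def energyJet (k : ℕ) (α s : ℝ) (p : Fin n → ℝ) (H : Matrix (Fin n) (Fin n) ℝ) : ℝ :=
  ∑ m ∈ Finset.range (k + 1), s ^ α * (p ⬝ᵥ p) ^ (k - m) * sig m (jetA s p H)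

/-- Young's inequality for the positive semidefinite form `T`. -/
theorem neg_le_two_mul_of_posSemidef {T : Matrix (Fin n) (Fin n) ℝ} (hT : T.PosSemidef)
    (p θ : Fin n → ℝ) (η s : ℝ) {ε : ℝ} (hε : 0 < ε) :
    -(ε * η ^ 2 * (p ⬝ᵥ (T *ᵥ p)) + ε⁻¹ * s ^ 2 * (θ ⬝ᵥ (T *ᵥ θ)))
      ≤ 2 * η * s * (θ ⬝ᵥ (T *ᵥ p)) := by
  have h := hT.dotProduct_mulVec_nonneg ((ε * η) • p + s • θ)
  have hs : p ⬝ᵥ (T *ᵥ θ) = θ ⬝ᵥ (T *ᵥ p) := by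
    have hTt : Tᵀ = T := by
      have := hT.isHermitian
      rwa [IsHermitian, conjTranspose_eq_transpose_of_trivial] at this
    rw [dotProduct_mulVec, ← mulVec_transpose, hTt, dotProduct_comm]
  simp only [star_trivial, mulVec_add, mulVec_smul, add_dotProduct, dotProduct_add,
    smul_dotProduct, dotProduct_smul, smul_eq_mul, hs] at h
  have h2 := mul_nonneg (inv_pos.2 hε).le h
  have e : ε⁻¹ * ε = 1 := inv_mul_cancel₀ hε.ne'
  have h3 : ε⁻¹ * (ε * η * (ε * η * p ⬝ᵥ T *ᵥ p) + s * (ε * η * θ ⬝ᵥ T *ᵥ p)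
      + (ε * η * (s * θ ⬝ᵥ T *ᵥ p) + s * (s * θ ⬝ᵥ T *ᵥ θ)))
      = ε * η ^ 2 * (p ⬝ᵥ T *ᵥ p) + 2 * η * s * (θ ⬝ᵥ T *ᵥ p) + ε⁻¹ * s ^ 2 * (θ ⬝ᵥ T *ᵥ θ) := by
    linear_combination (ε * η ^ 2 * (p ⬝ᵥ T *ᵥ p) + 2 * η * s * (θ ⬝ᵥ T *ᵥ p)) * e
  have h4 : 0 ≤ ε⁻¹ * (ε * η * (ε * η * p ⬝ᵥ T *ᵥ p) + s * (ε * η * θ ⬝ᵥ T *ᵥ p)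
      + (ε * η * (s * θ ⬝ᵥ T *ᵥ p) + s * (s * θ ⬝ᵥ T *ᵥ θ))) := by
    refine h2.trans (le_of_eq ?_)
    ring
  rw [h3] at h4
  linarith

/-- The pointwise inequality obtained from the weighted divergence formulas with cutoff `η²`: the
energy of order `k` is controlled by divergences and by the energy of order `k - 1` with exponent
`α + 2`. -/
theorem exists_pointwise_bound (n : ℕ) {k : ℕ} (hk : 1 ≤ k) (hkn : 2 * k ≤ n) {α : ℝ}
    (hα : 0 < α + 2 * (k : ℝ)) :
    ∃ (c : ℕ → ℝ) (δ C : ℝ), 0 < δ ∧ 0 < C ∧ ∀ (s η : ℝ) (p θ : Fin n → ℝ)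
      (H : Matrix (Fin n) (Fin n) ℝ), 0 < s → Hᵀ = H → eigenvalues (jetA s p H) ∈ gardingCone k →
      δ * (η ^ 2 * energyJet k α s p H) ≤
        ∑ i ∈ Finset.range k, c i * flux α (k - 1 - i) i (η ^ 2) ((2 * η) • θ) s p H
        + C * ((θ ⬝ᵥ θ) * energyJet (k - 1) (α + 2) s p H) := by
  obtain ⟨c, δ, hc, hδ, hcomb⟩ := exists_weights n hk hkn hα
  obtain ⟨ε, hε, hεc⟩ := exists_pos_forall_le (f := fun i => δ / c i) k fun i hi =>
    div_pos hδ (hc i hi)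
  have hεc' : ∀ i < k, c i * ε ≤ δ := fun i hi => by
    have := hεc i hi
    rwa [le_div_iff₀ (hc i hi), mul_comm] at this
  have hsum0 : 0 ≤ ∑ i ∈ Finset.range k, c i :=
    Finset.sum_nonneg fun i hi => (hc i (Finset.mem_range.1 hi)).le
  refine ⟨c, δ, ε⁻¹ * n * (∑ i ∈ Finset.range k, c i) + 1, hδ, by positivity, ?_⟩
  intro s η p θ H hs hH hcone
  set A := jetA s p H with hA
  set P := p ⬝ᵥ p with hP
  have hAH : A.IsHermitian := isHermitian_jetA s p hH
  have hP0 : 0 ≤ P := Finset.sum_nonneg fun i _ => mul_self_nonneg _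
  have hθ0 : 0 ≤ θ ⬝ᵥ θ := Finset.sum_nonneg fun i _ => mul_self_nonneg _
  have hsα : 0 < s ^ α := Real.rpow_pos_of_pos hs α
  have hsα1 : s ^ (α + 1) = s ^ α * s := by rw [Real.rpow_add hs, Real.rpow_one]
  have hsα2 : s ^ (α + 2) = s ^ α * s ^ 2 := by
    rw [Real.rpow_add hs, Real.rpow_two]
  have hT : ∀ i < k, (newton i A).PosSemidef := by
    intro i hi
    obtain ⟨K, rfl⟩ := Nat.exists_eq_add_of_le' hk
    exact newton_posSemidef hAH hcone (by omega)
  have hsig : ∀ m ≤ k, 0 ≤ sig m A := by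
    intro m hm
    rcases Nat.eq_zero_or_pos m with rfl | h
    · rw [sig_zero]; exact zero_le_one
    · exact (mem_gardingCone_iff hAH k).1 hcone m h hm
  set X : ℕ → ℝ := fun m => s ^ α * P ^ (k - m) * sig m A with hX
  set Y : ℕ → ℝ := fun i => s ^ α * P ^ (k - 1 - i) * (p ⬝ᵥ (newton i A *ᵥ p)) with hY
  have hX0 : ∀ m ≤ k, 0 ≤ X m := fun m hm =>
    mul_nonneg (mul_nonneg hsα.le (pow_nonneg hP0 _)) (hsig m hm)
  have hY0 : ∀ i < k, 0 ≤ Y i := fun i hi =>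
    mul_nonneg (mul_nonneg hsα.le (pow_nonneg hP0 _))
      (by simpa using (hT i hi).dotProduct_mulVec_nonneg p)
  have hXY : X 0 = Y 0 := by
    simp only [hX, hY, sig_zero, newton_zero, one_mulVec, Nat.sub_zero, ← hP]
    obtain ⟨K, rfl⟩ := Nat.exists_eq_add_of_le' hk
    simp only [Nat.add_sub_cancel, pow_succ]
    ring
  have hmain := hcomb X Y hX0 hY0 hXY
  have hflux : ∀ i < k, flux α (k - 1 - i) i (η ^ 2) ((2 * η) • θ) s p H
      = s ^ α * P ^ (k - 1 - i) * (2 * η * s * (θ ⬝ᵥ (newton i A *ᵥ p)))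
        + η ^ 2 * ((2 * k - 1 - i) * X (i + 1) - (n - i) / 2 * X i
          + (α + n + k - i) * Y i - 2 * (k - 1 - i) * Y (i + 1)) := by
    intro i hi
    have hcast : ((k - 1 - i : ℕ) : ℝ) = k - 1 - i := by
      rw [Nat.cast_sub (by omega), Nat.cast_sub (by omega)]; simp
    have e1 : k - (i + 1) = k - 1 - i := by omega
    have e2 : k - i = k - 1 - i + 1 := by omega
    have e3 : k - 1 - (i + 1) = k - 1 - i - 1 := by omega
    simp only [flux, hX, hY, ← hA, ← hP, hcast, e1, e2, e3, hsα1, smul_dotProduct, smul_eq_mul]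
    ring
  have hyoung : ∀ i < k, c i * (s ^ α * P ^ (k - 1 - i) * (2 * η * s * (θ ⬝ᵥ (newton i A *ᵥ p))))
      ≥ -(δ * η ^ 2 * Y i) - ε⁻¹ * n * c i * ((θ ⬝ᵥ θ) *
        (s ^ (α + 2) * P ^ (k - 1 - i) * sig i A)) := by
    intro i hi
    have h1 := neg_le_two_mul_of_posSemidef (hT i hi) p θ η s hε
    have h2 : θ ⬝ᵥ (newton i A *ᵥ θ) ≤ n * sig i A * (θ ⬝ᵥ θ) := by
      refine (dotProduct_mulVec_le_trace (hT i hi) θ).trans ?_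
      rw [trace_newton]
      have hi0 : (0 : ℝ) ≤ i := Nat.cast_nonneg i
      have := hsig i hi.le
      exact mul_le_mul_of_nonneg_right (mul_le_mul_of_nonneg_right (by linarith) this) hθ0
    have hci := hc i hi
    have hw : 0 ≤ c i * (s ^ α * P ^ (k - 1 - i)) :=
      mul_nonneg hci.le (mul_nonneg hsα.le (pow_nonneg hP0 _))
    have h3 := mul_le_mul_of_nonneg_left h1 hw
    have h4 : c i * (s ^ α * P ^ (k - 1 - i)) * (ε⁻¹ * s ^ 2 * (θ ⬝ᵥ (newton i A *ᵥ θ)))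
        ≤ ε⁻¹ * n * c i * ((θ ⬝ᵥ θ) * (s ^ (α + 2) * P ^ (k - 1 - i) * sig i A)) := by
      refine (mul_le_mul_of_nonneg_left (mul_le_mul_of_nonneg_left h2
        (mul_nonneg (inv_pos.2 hε).le (sq_nonneg s))) hw).trans (le_of_eq ?_)
      rw [hsα2]; ring
    have h5 : c i * ε * (η ^ 2 * Y i) ≤ δ * (η ^ 2 * Y i) :=
      mul_le_mul_of_nonneg_right (hεc' i hi) (mul_nonneg (sq_nonneg η) (hY0 i hi))
    have h6 : c i * (s ^ α * P ^ (k - 1 - i)) * (ε * η ^ 2 * (p ⬝ᵥ (newton i A *ᵥ p)))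
        = c i * ε * (η ^ 2 * Y i) := by
      simp only [hY]; ring
    nlinarith
  have hE : energyJet k α s p H = ∑ m ∈ Finset.range (k + 1), X m := rfl
  have hE' : energyJet (k - 1) (α + 2) s p H
      = ∑ i ∈ Finset.range k, s ^ (α + 2) * P ^ (k - 1 - i) * sig i A := by
    rw [energyJet, Nat.sub_add_cancel hk]
  have hE'0 : ∀ i ∈ Finset.range k, 0 ≤ s ^ (α + 2) * P ^ (k - 1 - i) * sig i A := fun i hi =>
    mul_nonneg (mul_nonneg (Real.rpow_pos_of_pos hs _).le (pow_nonneg hP0 _))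
      (hsig i (Finset.mem_range.1 hi).le)
  have hfl : ∑ i ∈ Finset.range k, c i * flux α (k - 1 - i) i (η ^ 2) ((2 * η) • θ) s p H
      ≥ η ^ 2 * (δ * (∑ m ∈ Finset.range (k + 1), X m + ∑ i ∈ Finset.range k, Y i))
        - δ * η ^ 2 * ∑ i ∈ Finset.range k, Y i
        - ∑ i ∈ Finset.range k, ε⁻¹ * n * c i * ((θ ⬝ᵥ θ) *
          (s ^ (α + 2) * P ^ (k - 1 - i) * sig i A)) := by
    have h1 := mul_le_mul_of_nonneg_left hmain (sq_nonneg η)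
    have h2 : ∑ i ∈ Finset.range k, c i * flux α (k - 1 - i) i (η ^ 2) ((2 * η) • θ) s p H
        ≥ ∑ i ∈ Finset.range k, ((-(δ * η ^ 2 * Y i) - ε⁻¹ * n * c i * ((θ ⬝ᵥ θ) *
          (s ^ (α + 2) * P ^ (k - 1 - i) * sig i A)))
          + η ^ 2 * (c i * ((2 * k - 1 - i) * X (i + 1) - (n - i) / 2 * X i
          + (α + n + k - i) * Y i - 2 * (k - 1 - i) * Y (i + 1)))) := by
      rw [ge_iff_le]
      refine Finset.sum_le_sum fun i hi => ?_
      have hi' := Finset.mem_range.1 hi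
      have := hyoung i hi'
      rw [hflux i hi', mul_add]
      linarith
    rw [Finset.sum_add_distrib, Finset.sum_sub_distrib, Finset.sum_neg_distrib, ← Finset.mul_sum,
      ← Finset.mul_sum (a := η ^ 2)] at h2
    linarith
  have hlast : ∑ i ∈ Finset.range k, ε⁻¹ * n * c i * ((θ ⬝ᵥ θ) *
      (s ^ (α + 2) * P ^ (k - 1 - i) * sig i A))
      ≤ (ε⁻¹ * n * (∑ i ∈ Finset.range k, c i) + 1) *
        ((θ ⬝ᵥ θ) * energyJet (k - 1) (α + 2) s p H) := by
    rw [hE', Finset.mul_sum (a := θ ⬝ᵥ θ), Finset.mul_sum (s := Finset.range k)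
      (f := fun i => (θ ⬝ᵥ θ) * (s ^ (α + 2) * P ^ (k - 1 - i) * sig i A))]
    refine Finset.sum_le_sum fun i hi => ?_
    refine mul_le_mul_of_nonneg_right ?_ (mul_nonneg hθ0 (hE'0 i hi))
    have h1 : c i ≤ ∑ i ∈ Finset.range k, c i :=
      Finset.single_le_sum (f := c) (fun j hj => (hc j (Finset.mem_range.1 hj)).le) hi
    have h2 : 0 ≤ ε⁻¹ * (n : ℝ) := by positivity
    nlinarith [mul_le_mul_of_nonneg_left h1 h2]
  rw [hE]
  nlinarith

end

/-! ### Induction on the order and the estimate -/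

section

open Matrix

variable {n : ℕ}

/-- The integrand of the estimate, `∑_m u^α |∇u|^{2(k-m)} S_m(u)`. -/
noncomputable def energy (k : ℕ) (α : ℝ) (u : EuclideanSpace ℝ (Fin n) → ℝ)
    (x : EuclideanSpace ℝ (Fin n)) : ℝ :=
  energyJet k α (u x) (grad u x) (hessian u x)

theorem integrand_eq_energy {u : EuclideanSpace ℝ (Fin n) → ℝ} {x : EuclideanSpace ℝ (Fin n)}
    (hu : ContDiffAt ℝ 2 u x) (k : ℕ) (α : ℝ) :
    ∑ l ∈ Finset.range (k + 1), u x ^ α * ‖gradient u x‖ ^ (2 * l) * S (k - l) u x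
      = energy k α u x := by
  rw [energy, energyJet, ← Finset.sum_range_reflect]
  refine Finset.sum_congr rfl fun l hl => ?_
  have hl' := Finset.mem_range.1 hl
  rw [S_eq_sig hu, pow_mul, norm_gradient_sq]
  congr 3; omega

/-- The quantities in the energy are nonnegative on Gårding's cone. -/
theorem energyJet_nonneg {k : ℕ} (α : ℝ) {s : ℝ} (hs : 0 < s) (p : Fin n → ℝ)
    {H : Matrix (Fin n) (Fin n) ℝ} (hH : Hᵀ = H)
    (h : eigenvalues (jetA s p H) ∈ gardingCone k) : 0 ≤ energyJet k α s p H := by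
  refine Finset.sum_nonneg fun m hm => ?_
  have hP0 : 0 ≤ p ⬝ᵥ p := Finset.sum_nonneg fun i _ => mul_self_nonneg _
  refine mul_nonneg (mul_nonneg (Real.rpow_pos_of_pos hs _).le (pow_nonneg hP0 _)) ?_
  rcases Nat.eq_zero_or_pos m with rfl | h0
  · rw [sig_zero]; exact zero_le_one
  · exact (mem_gardingCone_iff (isHermitian_jetA s p hH) k).1 h m h0
      (Nat.lt_succ_iff.1 (Finset.mem_range.1 hm))

theorem energy_nonneg {k : ℕ} (α : ℝ) {u : EuclideanSpace ℝ (Fin n) → ℝ}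
    (hu : u ∈ PhiTilde k (Metric.ball 0 3)) {x : EuclideanSpace ℝ (Fin n)}
    (hx : x ∈ Metric.ball (0 : EuclideanSpace ℝ (Fin n)) 3) : 0 ≤ energy k α u x := by
  refine energyJet_nonneg α (hu.2.1 x hx) _
    (hessian_transpose (hu.1.contDiffAt (Metric.isOpen_ball.mem_nhds hx))) ?_
  rw [← schouten_eq_jetA]
  exact hu.2.2 x hx

theorem phiTilde_of_succ {k : ℕ} {Ω : Set (EuclideanSpace ℝ (Fin n))}
    {u : EuclideanSpace ℝ (Fin n) → ℝ} (hu : u ∈ PhiTilde (k + 1) Ω) : u ∈ PhiTilde k Ω :=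
  ⟨hu.1, hu.2.1, fun x hx i h1 h2 => hu.2.2 x hx i h1 (by omega)⟩

theorem continuous_energy {w : EuclideanSpace ℝ (Fin n) → ℝ} (hw : ContDiff ℝ 2 w)
    (hpos : ∀ x, 0 < w x) (k : ℕ) (α : ℝ) : Continuous (energy k α w) := by
  have hg := continuous_grad (hw.of_le (by norm_num) : ContDiff ℝ 1 w)
  have hA : Continuous (fun x => jetA (w x) (grad w x) (hessian w x)) :=
    continuous_jetA.comp (hw.continuous.prodMk (hg.prodMk (continuous_hessian hw)))
  refine continuous_finsetSum (Finset.range (k + 1)) fun m _ => ((Continuous.rpow_const hw.continuous fun x =>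
    Or.inl (hpos x).ne').mul ((hg.dotProduct hg).pow _)).mul
      ((continuous_newton_sig m).2.comp hA)

theorem integrableOn_energy {u : EuclideanSpace ℝ (Fin n) → ℝ}
    (hu : ContDiffOn ℝ 2 u (Metric.ball 0 3)) (hpos : ∀ x ∈ Metric.ball 0 3, 0 < u x) (k : ℕ)
    (α : ℝ) {r : ℝ} (hr0 : 0 < r) (hr : r < 3) :
    IntegrableOn (energy k α u) (Metric.ball 0 r) := by
  obtain ⟨w, hw, hwpos, -, hwu⟩ := exists_extension hu hpos hr0 hr
  have h1 : IntegrableOn (energy k α w) (Metric.ball 0 r) :=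
    ((continuous_energy hw hwpos k α).continuousOn.integrableOn_compact
      (isCompact_closedBall 0 r)).mono_set Metric.ball_subset_closedBall
  refine h1.congr_fun (fun x hx => ?_) measurableSet_ball
  have he : w =ᶠ[𝓝 x] u := by
    filter_upwards [Metric.isOpen_ball.mem_nhds hx] with y hy using hwu y hy
  simp only [energy, he.eq_of_nhds, grad_congr he, hessian_congr he]

theorem integrableOn_rpow {u : EuclideanSpace ℝ (Fin n) → ℝ}
    (hu : ContinuousOn u (Metric.ball 0 3)) (hpos : ∀ x ∈ Metric.ball 0 3, 0 < u x) (β : ℝ)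
    {r : ℝ} (hr : r < 3) : IntegrableOn (fun x => u x ^ β) (Metric.ball 0 r) := by
  have hs : Metric.closedBall (0 : EuclideanSpace ℝ (Fin n)) r ⊆ Metric.ball 0 3 :=
    Metric.closedBall_subset_ball hr
  exact (((hu.mono hs).rpow_const fun x hx => Or.inl (hpos x (hs hx)).ne').integrableOn_compact
    (isCompact_closedBall 0 r)).mono_set Metric.ball_subset_closedBall

theorem grad_sq {η : EuclideanSpace ℝ (Fin n) → ℝ} (hη : ContDiff ℝ 1 η)
    (x : EuclideanSpace ℝ (Fin n)) : grad (fun y => η y ^ 2) x = (2 * η x) • grad η x := by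
  have h := (hη.differentiable (by simp) x).hasFDerivAt
  have h2 : fderiv ℝ (fun y => η y ^ 2) x = η x • fderiv ℝ η x + η x • fderiv ℝ η x := by
    simp only [sq]
    exact (h.fun_mul h).fderiv
  funext i
  simp [grad, h2]
  ring

/-- The integral estimate for the energy of order `k` in terms of `∫ u^{α+2k}`, by induction on
`k`. -/
theorem integral_energy_le (n k : ℕ) : ∀ α : ℝ, 0 < α + 2 * (k : ℝ) → 2 * k ≤ n →
    ∀ r R : ℝ, 0 < r → r < R → R < 3 → ∃ C : ℝ, 0 < C ∧ ∀ u : EuclideanSpace ℝ (Fin n) → ℝ,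
      u ∈ PhiTilde k (Metric.ball 0 3) →
      ∫ x in Metric.ball 0 r, energy k α u x ≤
        C * ∫ x in Metric.ball 0 R, u x ^ (α + 2 * (k : ℝ)) := by
  induction k with
  | zero =>
    intro α _ _ r R hr hrR hR
    refine ⟨1, one_pos, fun u hu => ?_⟩
    have e : ∀ x, energy 0 α u x = u x ^ (α + 2 * ((0 : ℕ) : ℝ)) := by
      intro x; simp [energy, energyJet, sig_zero]
    simp only [e, one_mul]
    refine setIntegral_mono_set (integrableOn_rpow hu.1.continuousOn hu.2.1 _ hR) ?_
      (Metric.ball_subset_ball hrR.le).eventuallyLE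
    filter_upwards [ae_restrict_mem measurableSet_ball] with x hx
    exact (Real.rpow_pos_of_pos (hu.2.1 x (Metric.ball_subset_ball hR.le hx)) _).le
  | succ k ih =>
    intro α hα hkn r R hr hrR hR
    set ρ := (2 * r + R) / 3 with hρ
    set ρ' := (r + 2 * R) / 3 with hρ'
    have hcast : α + 2 * ((k + 1 : ℕ) : ℝ) = α + 2 + 2 * (k : ℝ) := by push_cast; ring
    obtain ⟨C₁, hC₁, hih⟩ := ih (α + 2) (by rw [← hcast]; exact hα) (by omega) ρ' R
      (by linarith) (by linarith) hR
    obtain ⟨c, δ, C₂, hδ, hC₂, hpt⟩ := exists_pointwise_bound n (k := k + 1) (by omega) hkn hα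
    let η : ContDiffBump (0 : EuclideanSpace ℝ (Fin n)) := ⟨r, ρ, hr, by linarith⟩
    have hη1 : ContDiff ℝ 1 η := η.contDiff
    have hηt : tsupport η ⊆ Metric.ball 0 ρ' := by
      rw [η.tsupport_eq]
      exact Metric.closedBall_subset_ball (by change ρ < ρ'; linarith)
    obtain ⟨M, hM⟩ : ∃ M, ∀ x ∈ Metric.closedBall (0 : EuclideanSpace ℝ (Fin n)) R,
        ‖grad η x ⬝ᵥ grad η x‖ ≤ M :=
      (isCompact_closedBall _ _).exists_bound_of_continuousOn
        ((continuous_grad hη1).dotProduct (continuous_grad hη1)).continuousOn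
    have hM0 : 0 ≤ M := (norm_nonneg _).trans (hM 0 (by simp; linarith))
    refine ⟨δ⁻¹ * (C₂ * (M + 1) * C₁), by positivity, fun u hu => ?_⟩
    obtain ⟨huc, hupos, hucone⟩ := id hu
    set ζ : EuclideanSpace ℝ (Fin n) → ℝ := fun y => η y ^ 2 with hζ
    have hζ1 : ContDiff ℝ 1 ζ := hη1.pow 2
    have hζη : tsupport ζ ⊆ tsupport η := by
      refine closure_mono fun x hx hx' => hx ?_
      simp only [hζ, hx']; simp
    have hζc : HasCompactSupport ζ := η.hasCompactSupport.mono' (by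
      exact (subset_closure).trans hζη)
    have hfl : ∀ i, Integrable (fun x => flux α (k + 1 - 1 - i) i (ζ x) (grad ζ x) (u x)
        (grad u x) (hessian u x)) ∧ ∫ x, flux α (k + 1 - 1 - i) i (ζ x) (grad ζ x) (u x)
        (grad u x) (hessian u x) = 0 := fun i =>
      integral_flux_eq_zero α _ i huc hupos (R := ρ') (by linarith) (by linarith) hζ1 hζc
        (hζη.trans hηt)
    have hiE := integrableOn_energy huc hupos (k + 1) α hr (by linarith : r < 3)
    have hiE' := integrableOn_energy huc hupos k (α + 2) (by linarith : 0 < ρ')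
      (by linarith : ρ' < 3)
    have hρ'3 : Metric.ball (0 : EuclideanSpace ℝ (Fin n)) ρ' ⊆ Metric.ball 0 3 :=
      Metric.ball_subset_ball (by linarith)
    have hpoint : ∀ x, (Metric.ball 0 r).indicator (fun x => δ * energy (k + 1) α u x) x ≤
        ∑ i ∈ Finset.range (k + 1), c i * flux α (k + 1 - 1 - i) i (ζ x) (grad ζ x) (u x)
          (grad u x) (hessian u x)
        + (Metric.ball 0 ρ').indicator (fun x => C₂ * (M + 1) * energy k (α + 2) u x) x := by
      intro x
      by_cases hx : x ∈ Metric.ball (0 : EuclideanSpace ℝ (Fin n)) ρ'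
      · have hx3 := hρ'3 hx
        have hHs := hessian_transpose (huc.contDiffAt (Metric.isOpen_ball.mem_nhds hx3))
        have h1 := hpt (u x) (η x) (grad u x) (grad η x) (hessian u x) (hupos x hx3) hHs
          (by rw [← schouten_eq_jetA]; exact hucone x hx3)
        have hE0 := energy_nonneg α hu hx3
        have hE0' := energy_nonneg (α + 2) (phiTilde_of_succ hu) hx3
        have h2 : (Metric.ball 0 r).indicator (fun x => δ * energy (k + 1) α u x) x
            ≤ δ * (η x ^ 2 * energy (k + 1) α u x) := by
          by_cases hxr : x ∈ Metric.ball (0 : EuclideanSpace ℝ (Fin n)) r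
          · have : η x = 1 := η.one_of_mem_closedBall (Metric.ball_subset_closedBall hxr)
            rw [Set.indicator_of_mem hxr, this]
            simp
          · rw [Set.indicator_of_notMem hxr]
            positivity
        have h3 : grad η x ⬝ᵥ grad η x ≤ M + 1 := by
          have := hM x (Metric.ball_subset_closedBall (Metric.ball_subset_ball (by linarith) hx))
          have := (le_abs_self _).trans this
          linarith
        rw [Set.indicator_of_mem hx, grad_sq hη1]
        refine (h2.trans h1).trans (add_le_add le_rfl ?_)
        rw [mul_assoc]
        exact mul_le_mul_of_nonneg_left (mul_le_mul_of_nonneg_right h3 hE0') hC₂.le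
      · have hxt : x ∉ tsupport ζ := fun h => hx (hηt (hζη h))
        have hxr : x ∉ Metric.ball (0 : EuclideanSpace ℝ (Fin n)) r := fun h =>
          hx (Metric.ball_subset_ball (by linarith) h)
        rw [Set.indicator_of_notMem hx, Set.indicator_of_notMem hxr,
          (zero_of_notMem_tsupport hxt).1, (zero_of_notMem_tsupport hxt).2]
        simp [flux_zero]
    have hi1 : Integrable ((Metric.ball 0 r).indicator (fun x => δ * energy (k + 1) α u x)) :=
      (integrable_indicator_iff measurableSet_ball).2 (hiE.const_mul δ)
    have hi2 : Integrable ((Metric.ball 0 ρ').indicator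
        (fun x => C₂ * (M + 1) * energy k (α + 2) u x)) :=
      (integrable_indicator_iff measurableSet_ball).2 (hiE'.const_mul _)
    have hi3 : Integrable (fun x => ∑ i ∈ Finset.range (k + 1), c i * flux α (k + 1 - 1 - i) i
        (ζ x) (grad ζ x) (u x) (grad u x) (hessian u x)) :=
      integrable_finsetSum _ fun i _ => (hfl i).1.const_mul _
    have hmono := integral_mono hi1 (hi3.add hi2) hpoint
    have hz : ∫ x, ∑ i ∈ Finset.range (k + 1), c i * flux α (k + 1 - 1 - i) i
        (ζ x) (grad ζ x) (u x) (grad u x) (hessian u x) = 0 := by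
      rw [integral_finsetSum _ fun i _ => (hfl i).1.const_mul _]
      refine Finset.sum_eq_zero fun i _ => ?_
      rw [integral_const_mul, (hfl i).2, mul_zero]
    simp only [Pi.add_apply] at hmono
    rw [integral_add hi3 hi2, hz, zero_add, integral_indicator measurableSet_ball,
      integral_indicator measurableSet_ball, integral_const_mul, integral_const_mul] at hmono
    have hfin := hih u (phiTilde_of_succ hu)
    rw [← hcast] at hfin
    rw [mul_assoc, ← div_eq_inv_mul, le_div_iff₀ hδ, mul_comm]
    refine hmono.trans ?_
    rw [mul_assoc (C₂ * (M + 1))]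
    exact mul_le_mul_of_nonneg_left hfin (by positivity)

end

end SigmaKYamabe

open SigmaKYamabe

theorem lemma5p2 (n k : ℕ) (hk : 1 ≤ k) (hkn : 2 * k ≤ n) (α : ℝ) (hα : 0 < α + 2 * (k : ℝ)) :
    ∃ C : ℝ, 0 < C ∧
      ∀ u : EuclideanSpace ℝ (Fin n) → ℝ,
        u ∈ SigmaKYamabe.Phi k (Metric.ball 0 3) →
        ContDiffOn ℝ 2 u (Metric.ball 0 3) →
        IntegrableOn u (Metric.ball 0 2) volume ∧
        IntegrableOn
          (fun x => ∑ l ∈ Finset.range (k + 1),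
            u x ^ α * ‖gradient u x‖ ^ (2 * l) * SigmaKYamabe.S (k - l) u x)
          (Metric.ball 0 1) volume ∧
        ∫ x in Metric.ball 0 1, ∑ l ∈ Finset.range (k + 1),
            u x ^ α * ‖gradient u x‖ ^ (2 * l) * SigmaKYamabe.S (k - l) u x
          ≤ C * (∫ x in Metric.ball 0 2, |u x|) ^ (2 * (k : ℝ) + α) := by
  obtain ⟨C₁, hC₁, hest⟩ := integral_energy_le n k α hα hkn 1 (3 / 2) one_pos (by norm_num)
    (by norm_num)
  set w := ∫ y, weight (n := n) y with hw
  have hw0 : 0 < w := integral_weight_pos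
  set B := w⁻¹ * ((1 / 2 : ℝ) ^ n)⁻¹ with hB
  have hB0 : 0 < B := by positivity
  set V := volume.real (Metric.ball (0 : EuclideanSpace ℝ (Fin n)) (3 / 2)) with hV
  refine ⟨C₁ * (V + 1) * B ^ (2 * (k : ℝ) + α), by positivity, fun u hu hu2 => ?_⟩
  have huT := mem_phiTilde hk hu hu2
  obtain ⟨-, hpos, -⟩ := id huT
  have hcb : Metric.closedBall (0 : EuclideanSpace ℝ (Fin n)) 2 ⊆ Metric.ball 0 3 :=
    Metric.closedBall_subset_ball (by norm_num)
  have hui : IntegrableOn u (Metric.ball 0 2) :=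
    ((hu2.continuousOn.mono hcb).integrableOn_compact (isCompact_closedBall 0 2)).mono_set
      Metric.ball_subset_closedBall
  have hcong : ∀ x ∈ Metric.ball (0 : EuclideanSpace ℝ (Fin n)) 1,
      ∑ l ∈ Finset.range (k + 1), u x ^ α * ‖gradient u x‖ ^ (2 * l) * S (k - l) u x
        = energy k α u x := fun x hx =>
    integrand_eq_energy (hu2.contDiffAt (Metric.isOpen_ball.mem_nhds
      (Metric.ball_subset_ball (by norm_num) hx))) k α
  refine ⟨hui, ?_, ?_⟩
  · exact (integrableOn_energy hu2 hpos k α one_pos (by norm_num)).congr_fun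
      (fun x hx => (hcong x hx).symm) measurableSet_ball
  rw [setIntegral_congr_fun measurableSet_ball hcong]
  refine (hest u huT).trans ?_
  set I := ∫ x in Metric.ball 0 2, |u x| with hI
  have hI0 : 0 ≤ I := integral_nonneg fun x => abs_nonneg _
  -- the supremum of `u` on `B_{3/2}` is controlled by the mean value inequality
  have hsup : ∀ x ∈ Metric.ball (0 : EuclideanSpace ℝ (Fin n)) (3 / 2), u x ≤ B * I := by
    intro x hx
    have hx' : ‖x‖ < 3 / 2 := by simpa using hx
    have hsub : Metric.ball x (1 / 2) ⊆ Metric.ball 0 2 :=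
      Metric.ball_subset_ball' (by rw [dist_zero_right]; linarith)
    have h1 := mean_value_weight hu2 hpos (trace_hessian_nonneg hk Metric.isOpen_ball huT)
      (x := x) (r := 1 / 2) (by norm_num) (by linarith)
    have h2 := abs_integral_weight_le (x := x) (r := 1 / 2) (by norm_num) (hui.mono_set hsub)
    have h3 : ∫ z in Metric.ball x (1 / 2), |u z| ≤ I :=
      setIntegral_mono_set hui.abs (Eventually.of_forall fun z => abs_nonneg _) hsub.eventuallyLE
    have h4 : w * u x ≤ ((1 / 2 : ℝ) ^ n)⁻¹ * I :=
      h1.trans ((le_abs_self _).trans (h2.trans (mul_le_mul_of_nonneg_left h3 (by positivity))))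
    rw [hB, mul_assoc, ← div_eq_inv_mul, le_div_iff₀ hw0, mul_comm]
    exact h4
  have hb3 : Metric.ball (0 : EuclideanSpace ℝ (Fin n)) (3 / 2) ⊆ Metric.ball 0 3 :=
    Metric.ball_subset_ball (by norm_num)
  have hint : ∫ x in Metric.ball 0 (3 / 2), u x ^ (α + 2 * (k : ℝ))
      ≤ V * (B * I) ^ (α + 2 * (k : ℝ)) := by
    have h := setIntegral_mono_on (g := fun _ => (B * I) ^ (α + 2 * (k : ℝ)))
      (integrableOn_rpow hu2.continuousOn hpos (α + 2 * (k : ℝ)) (by norm_num : (3 / 2 : ℝ) < 3))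
      (integrableOn_const measure_ball_lt_top.ne) measurableSet_ball fun x hx =>
        Real.rpow_le_rpow (hpos x (hb3 hx)).le (hsup x hx) hα.le
    rwa [setIntegral_const, smul_eq_mul] at h
  rw [add_comm α, Real.mul_rpow hB0.le hI0] at hint
  have hI' : 0 ≤ I ^ (2 * (k : ℝ) + α) := Real.rpow_nonneg hI0 _
  have hB' : 0 < B ^ (2 * (k : ℝ) + α) := Real.rpow_pos_of_pos hB0 _
  rw [add_comm α]
  calc C₁ * ∫ x in Metric.ball 0 (3 / 2), u x ^ (2 * (k : ℝ) + α)
      ≤ C₁ * (V * (B ^ (2 * (k : ℝ) + α) * I ^ (2 * (k : ℝ) + α))) :=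
        mul_le_mul_of_nonneg_left hint hC₁.le
    _ ≤ C₁ * ((V + 1) * (B ^ (2 * (k : ℝ) + α) * I ^ (2 * (k : ℝ) + α))) := by
        gcongr
        linarith
    _ = C₁ * (V + 1) * B ^ (2 * (k : ℝ) + α) * I ^ (2 * (k : ℝ) + α) := by ring
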